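/- Let $n\ge 1$, $N\in\mathbb N$, and let $\mathcal G$ be a directed graph without self-loops on the vertices $0,1,\dots,N$, where $w_{ij}=1$ if node $j$ transfers its information to node $i$ and $w_{ij}=0$ otherwise. Assume that vertex $0$ (the leader) is a root: it receives no information ($w_{0j}=0$ for all $j$), and every vertex $1,\dots,N$ (the followers) can be reached from it by a directed path. The agents have the dynamics $\dot x_i=Ax_i+Bu_i$, $x_i\in\mathbb R^n$, $u_i\in\mathbb R$, $i=0,\dots,N$, $u_0=0$, where $A\in\mathbb R^{n\times n}$ is the upper shift matrix (ones on the first superdiagonal, zeros elsewhere) and $B=(0,\dots,0,1)^\top$. Put $e_i=x_i-x_0$ for $i=1,\dots,N$ and $e=(e_1,\dots,e_N)$. Let $-1\le\mu<\frac1{n-1}$ (for $n=1$: $-1\le\mu<\infty$), $G_{\mathbf d}=\mathrm{diag}\{1-\mu(n-k)\}_{k=1}^n$ and $\mathbf d(s)=\exp(sG_{\mathbf d})$, and let $X\in\mathbb R^{n\times n}$, $Y\in\mathbb R^{1\times n}$ satisfy $$X\succ0,\qquad G_{\mathbf d}X+XG_{\mathbf d}\succ0,\qquad AX+XA^\top-BY-Y^\top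 B^\top\prec0 .$$ Put $P=X^{-1}$, $K=YX^{-1}$ and $\|x\|_P=\sqrt{x^\top Px}$. Let $\|\cdot\|_{\mathbf d}$ be the canonical homogeneous norm induced by $\|\cdot\|_P$: $\|0\|_{\mathbf d}=0$, and for $x\ne0$, $\|x\|_{\mathbf d}=e^{s}$ where $\|\mathbf d(-s)x\|_P=1$. Consider the equations $$v_0=0,\qquad v_i=\frac1{\sum_{j=0}^Nw_{ij}}\sum_{j=0}^Nw_{ij}(x_i-x_j+v_j),\qquad i=1,\dots,N, \tag{1}$$ $$u_i=-\|v_i\|_{\mathbf d}^{1+\mu}\,K\,\mathbf d(-\ln\|v_i\|_{\mathbf d})\,v_i,\qquad i=1,\dots,N, \tag{2}$$ where the right-hand side of (2) is read as $0$ if $v_i=0$. Then: 1. For every $x\neq0$ the function $s\mapsto\|\mathbf d(s)x\|_P$ is strictly increasing and there is exactly one $s$ with $\|\mathbf d(-s)x\|_P=1$, so that $\|\cdot\|_{\mathbf d}$ is well defined. Moreover $\sum_jw_{ij}>0$ for $i=1,\dots,N$. 2. For all states $x_0,\dots,x_N$, equation (1) has the unique solution $v_0=0$, $v_i=e_i$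 ($i=1,\dots,N$), and hence (1), (2) determine the inputs $u_i$ uniquely. With these inputs (and $u_0=0$) the error obeys the closed-loop equation $$\dot e_i=f_i(e):=\left(A-\|e_i\|_{\mathbf d}^{1+\mu}BK\mathbf d(-\ln\|e_i\|_{\mathbf d})\right)e_i,\qquad i=1,\dots,N. \tag{3}$$ 3. System (3) is well posed: for every initial state $e(0)\in\mathbb R^{Nn}$ it has a solution on $[0,\infty)$, and every solution on an interval $[0,T)$ with the same initial state coincides with it on $[0,T)$. 4. If $\mu\in[-1,0)$, then (3) is globally finite-time stable: the origin is Lyapunov stable, and there is a settling-time function $T:\mathbb R^{Nn}\to(0,\infty)$ such that every solution on $[0,\infty)$ satisfies $e(t)=0$ for all $t\ge T(e(0))$. Here solutions are classical if $\mu\neq-1$; if $\mu=-1$, where $f$ is discontinuous, they are Filippov solutions, i.e. locally absolutely continuous functions with $\dot e(t)\in\bigcap_{\delta>0}\bigcap_{|S|=0}\overline{\mathrm{co}}\,f(B(e(t),\delta)\setminus S)$ for almost every $t$. -/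

import Mathlib

open MeasureTheory

noncomputable section

namespace LeaderFollowing

/-! ### Communication graph: vertex `0` is the leader, vertices `i.succ` are the followers -/

/-- `r` is a root of the directed graph `G`, where `G.Adj i j` means that node `j` transfers its
information to node `i`: there is a directed path from `r` to every other node, and `r` receives
no information. -/
def IsRoot {V : Type*} (G : Digraph V) (r : V) : Prop :=
  (∀ i, i ≠ r → Relation.TransGen (fun a b => G.Adj b a) r i) ∧ ∀ j, ¬ G.Adj r j

open Classical in
/-- Entry `w i j` of the weighted adjacency matrix. -/
def weight {V : Type*} (G : Digraph V) (i j : V) : ℝ := if G.Adj i j then 1 else 0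

/-! ### Agent dynamics `ẋ = A x + B u` (integrator chain) -/

/-- The upper shift matrix `A`. -/
def matA (n : ℕ) : Matrix (Fin n) (Fin n) ℝ :=
  Matrix.of fun i j => if (j : ℕ) = (i : ℕ) + 1 then 1 else 0

/-- The column `B = (0, …, 0, 1)ᵀ`. -/
def matB (n : ℕ) : Matrix (Fin n) (Fin 1) ℝ :=
  Matrix.of fun i _ => if (i : ℕ) + 1 = n then 1 else 0

/-- The right-hand side `A x + B u` of the dynamics of one agent with scalar input `u`. -/
def agentField (n : ℕ) (x : Fin n → ℝ) (u : ℝ) : Fin n → ℝ :=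
  Matrix.mulVec (matA n) x + Matrix.mulVec (matB n) (fun _ => u)

/-! ### Dilation and canonical homogeneous norm -/

/-- The generator `diag {1 - μ (n - k)}`, `k = 1, …, n` (here `k` is the index plus one). -/
def genG (n : ℕ) (μ : ℝ) : Matrix (Fin n) (Fin n) ℝ :=
  Matrix.diagonal fun k => 1 - μ * ((n : ℝ) - ((k : ℕ) + 1 : ℝ))

/-- The linear dilation `d(s) = exp (s G_d)`. -/
def dil (n : ℕ) (μ s : ℝ) : Matrix (Fin n) (Fin n) ℝ := NormedSpace.exp (s • genG n μ)

/-- The weighted Euclidean norm `‖x‖_P = √(xᵀ P x)`. -/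
def wnorm {n : ℕ} (P : Matrix (Fin n) (Fin n) ℝ) (x : Fin n → ℝ) : ℝ :=
  Real.sqrt (dotProduct x (Matrix.mulVec P x))

/-- The canonical homogeneous norm induced by `‖·‖_P`: `‖0‖_d = 0`, and `‖x‖_d = exp s` where
`‖d(-s) x‖_P = 1`. -/
def hnorm {n : ℕ} (μ : ℝ) (P : Matrix (Fin n) (Fin n) ℝ) (x : Fin n → ℝ) : ℝ :=
  open Classical in
  if x = 0 then 0
  else Real.exp (Classical.epsilon fun s : ℝ => wnorm P (Matrix.mulVec (dil n μ (-s)) x) = 1)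

/-! ### The LMI, the transmitted vectors and the protocol -/

/-- `(X, Y)` solves `X ≻ 0`, `G_d X + X G_d ≻ 0`, `A X + X Aᵀ - B Y - Yᵀ Bᵀ ≺ 0`. -/
def SolvesLMI (n : ℕ) (μ : ℝ) (X : Matrix (Fin n) (Fin n) ℝ) (Y : Matrix (Fin 1) (Fin n) ℝ) :
    Prop :=
  X.PosDef ∧ (genG n μ * X + X * genG n μ).PosDef ∧
    (-(matA n * X + X * (matA n).transpose - matB n * Y
      - Y.transpose * (matB n).transpose)).PosDef

/-- The algebraic equations for the transmitted vectors: `v₀ = 0` and, for the followers,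
`vᵢ = (∑ⱼ wᵢⱼ)⁻¹ ∑ⱼ wᵢⱼ (xᵢ - xⱼ + vⱼ)`. -/
def TransmittedEq {n N : ℕ} (G : Digraph (Fin (N + 1))) (x v : Fin (N + 1) → Fin n → ℝ) : Prop :=
  v 0 = 0 ∧ ∀ i : Fin N, v i.succ =
    (1 / ∑ j, weight G i.succ j) • ∑ j, weight G i.succ j • (x i.succ - x j + v j)

/-- The equations for the inputs: `u₀ = 0` (leader) and, for the followers,
`uᵢ = -‖vᵢ‖_d ^ (1 + μ) K d(-ln ‖vᵢ‖_d) vᵢ`. -/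
def ProtocolEq {n N : ℕ} (μ : ℝ) (K : Matrix (Fin 1) (Fin n) ℝ) (P : Matrix (Fin n) (Fin n) ℝ)
    (v : Fin (N + 1) → Fin n → ℝ) (u : Fin (N + 1) → ℝ) : Prop :=
  u 0 = 0 ∧ ∀ i : Fin N, u i.succ =
    -((hnorm μ P (v i.succ)) ^ (1 + μ) *
      Matrix.mulVec (K * dil n μ (-Real.log (hnorm μ P (v i.succ)))) (v i.succ) 0)

/-- The closed-loop error field
`f(e)ᵢ = (A - ‖eᵢ‖_d ^ (1 + μ) B K d(-ln ‖eᵢ‖_d)) eᵢ`, `e = (e₁, …, e_N)`. -/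
def errorField (n N : ℕ) (μ : ℝ) (K : Matrix (Fin 1) (Fin n) ℝ) (P : Matrix (Fin n) (Fin n) ℝ)
    (e : Fin N → Fin n → ℝ) : Fin N → Fin n → ℝ := fun i =>
  Matrix.mulVec
    (matA n - (hnorm μ P (e i)) ^ (1 + μ) •
      (matB n * K * dil n μ (-Real.log (hnorm μ P (e i))))) (e i)

/-! ### Solutions and stability of `ė = f(e)` -/

section Solutions

variable {E : Type*} [NormedAddCommGroup E] [NormedSpace ℝ E] [MeasureSpace E]

/-- The Filippov set-valued regularization of `f`: intersection, over all `δ > 0` and all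
Lebesgue-null sets `S`, of the closed convex hull of the image under `f` of `B(x, δ) \ S`. -/
def filippov (f : E → E) (x : E) : Set E :=
  ⋂ (δ : ℝ) (_ : 0 < δ) (S : Set E) (_ : volume S = 0),
    closure (convexHull ℝ (f '' (Metric.ball x δ \ S)))

/-- `y` is a Filippov solution of `ẏ = f(y)` on the interval `J`: it is locally absolutely
continuous on `J` and its derivative lies in the Filippov set for almost every time. -/
def IsFilippovSolutionOn (f : E → E) (y : ℝ → E) (J : Set ℝ) : Prop :=
  (∀ a b, a ≤ b → Set.Icc a b ⊆ J → AbsolutelyContinuousOnInterval y a b) ∧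
    ∀ᵐ t : ℝ, t ∈ J → ∃ w ∈ filippov f (y t), HasDerivAt y w t

/-- Solutions on `J` of a homogeneous system of degree `μ`: classical solutions if `μ ≠ -1`,
Filippov solutions if `μ = -1` (where the field is discontinuous). -/
def IsSolutionOn (μ : ℝ) (f : E → E) (y : ℝ → E) (J : Set ℝ) : Prop :=
  (μ ≠ -1 → IsIntegralCurveOn y (fun _ => f) J) ∧ (μ = -1 → IsFilippovSolutionOn f y J)

/-- Every initial state is the start of a solution on `[0, ∞)`, and every solution on some
`[0, T)` with the same initial state coincides with it there. -/
def WellPosed (μ : ℝ) (f : E → E) : Prop :=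
  ∀ y₀ : E, ∃ y : ℝ → E, y 0 = y₀ ∧ IsSolutionOn μ f y (Set.Ici 0) ∧
    ∀ (T : ℝ) (z : ℝ → E), 0 < T → z 0 = y₀ → IsSolutionOn μ f z (Set.Ico 0 T) →
      ∀ t ∈ Set.Ico 0 T, z t = y t

/-- Global finite-time stability of the origin: Lyapunov stability, and a settling-time function
after which every solution is at the origin. -/
def GloballyFiniteTimeStable (μ : ℝ) (f : E → E) : Prop :=
  (∀ ε > 0, ∃ δ > 0, ∀ y : ℝ → E, IsSolutionOn μ f y (Set.Ici 0) → ‖y 0‖ < δ →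
    ∀ t, 0 ≤ t → ‖y t‖ < ε) ∧
  ∃ T : E → ℝ, (∀ y₀, 0 < T y₀) ∧ ∀ y : ℝ → E, IsSolutionOn μ f y (Set.Ici 0) →
    ∀ t, T (y 0) ≤ t → y t = 0

end Solutions

end LeaderFollowing

end

noncomputable section

namespace LeaderFollowing

open Set Filter Topology Matrix

/-! The maximum principle on the graph forces `v = e`, so the error system splits into independent
copies of one field on `ℝⁿ`. Since `A d(s) = e^{μs} d(s) A` and `d(s) B = e^s B`, that field is
`f(x) = e^{μσ} d(σ) M d(-σ) x` with `M = A - BK` and `σ = ln ‖x‖_d`. Congruence by `X⁻¹` turns the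
LMI into positivity of two quadratic forms: `p(x) = xᵀ P G_d x`, half the growth rate of `q(x) = xᵀ
P x` under the dilation, and `m(x) = -xᵀ P M x`.

Along a trajectory away from the origin, with `z = d(-σ) x`, one gets `σ' = -e^{μσ} m(z)/p(z) < 0`
(`hasDerivAt_logNorm`). Hence a trajectory that has reached the origin never leaves it
(`forall_ne_zero`). As `f` is `C¹` elsewhere, this gives uniqueness (`eq_of_initial_eq`), and the
monotonicity of `σ` gives Lyapunov stability. For `μ < 0`, `e^{-μσ}` decreases at a rate bounded
away from zero, because `m/p` is bounded below; this bounds the settling time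
(`exists_settlingTime`).

For existence, write `x = d(s)π` with `q(π) = 1`. In a suitable time, `π` solves a polynomial
equation on a compact ellipsoid and `s` is an integral along it (`exists_reparametrized_curve`).
Undoing the change of time, and continuing by zero if it covers only a finite interval, gives a
solution for every degree (`exists_solution`).

Classical and Filippov solutions are both reduced to a weak notion imposing only continuity at the
origin (`isWeakSolutionOn_of_isSolutionOn`), so uniqueness and stability are proved once.
Conversely, the constructed curve is a Filippov solution because `f` is odd: averaging `f` over
reflections puts the velocity `0` in the Filippov set (`prodField_mem_filippov`). -/

/-- A field homogeneous of degree `μ` for the dilation with weights `r`, given by its linear part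
`M` on the unit sphere of the quadratic form `P`, which is a Lyapunov function for `M` and is
increased by the dilation. -/
structure HomSystem (ι : Type*) [Fintype ι] where
  r : ι → ℝ
  P : Matrix ι ι ℝ
  M : Matrix ι ι ℝ
  μ : ℝ
  r_pos : ∀ k, 0 < r k
  P_symm : P.transpose = P
  P_pos : ∀ x : ι → ℝ, x ≠ 0 → 0 < x ⬝ᵥ P *ᵥ x
  G_pos : ∀ x : ι → ℝ, x ≠ 0 → 0 < x ⬝ᵥ P *ᵥ (r * x)
  M_neg : ∀ x : ι → ℝ, x ≠ 0 → x ⬝ᵥ P *ᵥ (M *ᵥ x) < 0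

/-- The quotient is continuous on the compact unit sphere, and the common degree two carries its
bound to all of the space. Every constant comparing `q`, `p`, `m` and the norm comes from here. -/
lemma exists_quadratic_le {E : Type*} [NormedAddCommGroup E] [NormedSpace ℝ E] [ProperSpace E]
    {Q₁ Q₂ : E → ℝ} (h₁ : Continuous Q₁) (h₂ : Continuous Q₂)
    (hom₁ : ∀ (c : ℝ) x, Q₁ (c • x) = c ^ 2 * Q₁ x) (hom₂ : ∀ (c : ℝ) x, Q₂ (c • x) = c ^ 2 * Q₂ x)
    (pos : ∀ x, x ≠ 0 → 0 < Q₂ x) : ∃ C > 0, ∀ x, Q₁ x ≤ C * Q₂ x := by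
  have hne : ∀ x ∈ Metric.sphere (0 : E) 1, x ≠ 0 := by
    rintro x hx rfl
    simp at hx
  obtain ⟨C, hC⟩ := (isCompact_sphere (0 : E) 1).exists_bound_of_continuousOn
    (f := fun x => Q₁ x / Q₂ x)
    (h₁.continuousOn.div h₂.continuousOn fun x hx => (pos x (hne x hx)).ne')
  refine ⟨max C 1, by positivity, fun x => ?_⟩
  rcases eq_or_ne x 0 with rfl | hx
  · have e₁ := hom₁ 0 0
    have e₂ := hom₂ 0 0
    rw [smul_zero, zero_pow two_ne_zero, zero_mul] at e₁ e₂
    simp [e₁, e₂]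
  · have hn : ‖x‖ ≠ 0 := norm_ne_zero_iff.2 hx
    set u : E := ‖x‖⁻¹ • x with hu
    have hus : u ∈ Metric.sphere (0 : E) 1 := by
      rw [mem_sphere_zero_iff_norm, hu, norm_smul, norm_inv, norm_norm, inv_mul_cancel₀ hn]
    have hxu : x = ‖x‖ • u := by
      rw [hu, smul_smul, mul_inv_cancel₀ hn, one_smul]
    have h2 := pos u (hne u hus)
    have hb := (le_abs_self _).trans (hC u hus)
    rw [div_le_iff₀ h2] at hb
    have : Q₁ u ≤ max C 1 * Q₂ u :=
      hb.trans (mul_le_mul_of_nonneg_right (le_max_left _ _) h2.le)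
    rw [hxu, hom₁, hom₂]
    nlinarith [mul_le_mul_of_nonneg_left this (sq_nonneg ‖x‖)]

/-! ### Quadratic forms, dilation and the homogeneous norm -/

namespace HomSystem

variable {ι : Type*} [Fintype ι] (S : HomSystem ι)

def q (x : ι → ℝ) : ℝ := x ⬝ᵥ S.P *ᵥ x

def p (x : ι → ℝ) : ℝ := x ⬝ᵥ S.P *ᵥ (S.r * x)

def m (x : ι → ℝ) : ℝ := -(x ⬝ᵥ S.P *ᵥ (S.M *ᵥ x))

/-- The dilation. -/
def scl (s : ℝ) (x : ι → ℝ) : ι → ℝ := fun k => Real.exp (s * S.r k) * x k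

lemma contDiff_mulVec {E : Type*} [NormedAddCommGroup E] [NormedSpace ℝ E] {n : WithTop ℕ∞}
    (A : Matrix ι ι ℝ) {f : E → ι → ℝ} (hf : ContDiff ℝ n f) :
    ContDiff ℝ n fun x => A *ᵥ f x := by
  rw [contDiff_pi] at hf ⊢
  intro i
  simp only [mulVec, dotProduct]
  fun_prop

lemma contDiff_dotProduct {E : Type*} [NormedAddCommGroup E] [NormedSpace ℝ E] {n : WithTop ℕ∞}
    {f g : E → ι → ℝ} (hf : ContDiff ℝ n f) (hg : ContDiff ℝ n g) :
    ContDiff ℝ n fun x => f x ⬝ᵥ g x := by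
  rw [contDiff_pi] at hf hg
  simp only [dotProduct]
  fun_prop

lemma contDiff_weight_mul {E : Type*} [NormedAddCommGroup E] [NormedSpace ℝ E] {n : WithTop ℕ∞}
    {f : E → ι → ℝ} (hf : ContDiff ℝ n f) : ContDiff ℝ n fun x => S.r * f x := by
  rw [contDiff_pi] at hf ⊢
  intro i
  simp only [Pi.mul_apply]
  fun_prop

lemma contDiff_q {n : WithTop ℕ∞} : ContDiff ℝ n S.q :=
  contDiff_dotProduct contDiff_id (contDiff_mulVec _ contDiff_id)

lemma contDiff_p {n : WithTop ℕ∞} : ContDiff ℝ n S.p :=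
  contDiff_dotProduct contDiff_id (contDiff_mulVec _ (S.contDiff_weight_mul contDiff_id))

lemma contDiff_m {n : WithTop ℕ∞} : ContDiff ℝ n S.m :=
  (contDiff_dotProduct contDiff_id
    (contDiff_mulVec _ (contDiff_mulVec _ contDiff_id))).neg

lemma contDiff_scl {E : Type*} [NormedAddCommGroup E] [NormedSpace ℝ E] {n : WithTop ℕ∞}
    {s : E → ℝ} {f : E → ι → ℝ} (hs : ContDiff ℝ n s) (hf : ContDiff ℝ n f) :
    ContDiff ℝ n fun x => S.scl (s x) (f x) := by
  rw [contDiff_pi] at hf ⊢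
  intro i
  simp only [scl]
  fun_prop

lemma contDiff_scl_uncurry {n : WithTop ℕ∞} :
    ContDiff ℝ n fun z : ℝ × (ι → ℝ) => S.scl z.1 z.2 :=
  S.contDiff_scl contDiff_fst contDiff_snd

lemma q_smul (c : ℝ) (x : ι → ℝ) : S.q (c • x) = c ^ 2 * S.q x := by
  simp [q, mulVec_smul, smul_dotProduct, dotProduct_smul]; ring

lemma p_smul (c : ℝ) (x : ι → ℝ) : S.p (c • x) = c ^ 2 * S.p x := by
  simp [p, mulVec_smul, smul_dotProduct, dotProduct_smul]; ring

lemma m_smul (c : ℝ) (x : ι → ℝ) : S.m (c • x) = c ^ 2 * S.m x := by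
  simp [m, mulVec_smul, smul_dotProduct, dotProduct_smul]; ring

lemma q_pos {x : ι → ℝ} (hx : x ≠ 0) : 0 < S.q x := S.P_pos x hx

lemma p_pos {x : ι → ℝ} (hx : x ≠ 0) : 0 < S.p x := S.G_pos x hx

lemma m_pos {x : ι → ℝ} (hx : x ≠ 0) : 0 < S.m x := neg_pos.2 (S.M_neg x hx)

@[simp] lemma q_zero : S.q 0 = 0 := by simp [q]

lemma q_nonneg (x : ι → ℝ) : 0 ≤ S.q x := by
  rcases eq_or_ne x 0 with rfl | hx
  · simp
  · exact (S.q_pos hx).le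

lemma ne_zero_of_q {x : ι → ℝ} (hx : S.q x = 1) : x ≠ 0 := by
  rintro rfl
  simp at hx

lemma exists_norm_sq_le : ∃ C > 0, ∀ x, ‖x‖ ^ 2 ≤ C * S.q x :=
  exists_quadratic_le (by fun_prop) (S.contDiff_q (n := 0)).continuous
    (fun c x => by rw [norm_smul, mul_pow, Real.norm_eq_abs, sq_abs]) S.q_smul fun _ => S.q_pos

lemma exists_q_le_m : ∃ c > 0, ∀ x, c * S.q x ≤ S.m x := by
  obtain ⟨C, hC, h⟩ := exists_quadratic_le (S.contDiff_q (n := 0)).continuous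
    (S.contDiff_m (n := 0)).continuous S.q_smul S.m_smul fun _ => S.m_pos
  exact ⟨C⁻¹, inv_pos.2 hC, fun x => by rw [inv_mul_le_iff₀ hC]; exact h x⟩

lemma exists_p_le_m : ∃ c > 0, ∀ x, c * S.p x ≤ S.m x := by
  obtain ⟨C, hC, h⟩ := exists_quadratic_le (S.contDiff_p (n := 0)).continuous
    (S.contDiff_m (n := 0)).continuous S.p_smul S.m_smul fun _ => S.m_pos
  exact ⟨C⁻¹, inv_pos.2 hC, fun x => by rw [inv_mul_le_iff₀ hC]; exact h x⟩

@[simp] lemma scl_zero_left (x : ι → ℝ) : S.scl 0 x = x := by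
  ext; simp [scl]

@[simp] lemma scl_zero_right (s : ℝ) : S.scl s 0 = 0 := by
  ext; simp [scl]

lemma scl_scl (s t : ℝ) (x : ι → ℝ) : S.scl s (S.scl t x) = S.scl (s + t) x := by
  ext; simp [scl, add_mul, Real.exp_add, mul_assoc]

lemma scl_neg_right (s : ℝ) (x : ι → ℝ) : S.scl s (-x) = -S.scl s x := by
  ext; simp [scl]

lemma scl_add_right (s : ℝ) (x y : ι → ℝ) : S.scl s (x + y) = S.scl s x + S.scl s y := by
  ext; simp [scl, mul_add]

lemma scl_smul_right (s c : ℝ) (x : ι → ℝ) : S.scl s (c • x) = c • S.scl s x := by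
  ext; simp [scl, mul_left_comm]

lemma scl_eq_zero {s : ℝ} {x : ι → ℝ} : S.scl s x = 0 ↔ x = 0 := by
  refine ⟨fun h => ?_, fun h => by simp [h]⟩
  have := congrArg (S.scl (-s)) h
  simpa [scl_scl] using this

lemma scl_ne_zero {s : ℝ} {x : ι → ℝ} (hx : x ≠ 0) : S.scl s x ≠ 0 := by
  rwa [Ne, scl_eq_zero]

lemma hasDerivAt_q {u : ℝ → ι → ℝ} {u' : ι → ℝ} {t : ℝ} (hu : HasDerivAt u u' t) :
    HasDerivAt (fun t => S.q (u t)) (2 * (u t ⬝ᵥ S.P *ᵥ u')) t := by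
  have hu' := hasDerivAt_pi.1 hu
  have h : HasDerivAt (fun t => S.q (u t)) (u' ⬝ᵥ S.P *ᵥ u t + u t ⬝ᵥ S.P *ᵥ u') t := by
    simp only [q, dotProduct, mulVec, ← Finset.sum_add_distrib]
    refine HasDerivAt.fun_sum fun i _ => (hu' i).mul ?_
    exact HasDerivAt.fun_sum fun j _ => (hu' j).const_mul _
  convert h using 1
  have : u' ⬝ᵥ S.P *ᵥ u t = u t ⬝ᵥ S.P *ᵥ u' := by
    conv_rhs => rw [dotProduct_mulVec, ← mulVec_transpose, S.P_symm, dotProduct_comm]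
  rw [this]; ring

lemma hasDerivAt_scl {s : ℝ → ℝ} {s' : ℝ} {u : ℝ → ι → ℝ} {u' : ι → ℝ} {t : ℝ}
    (hs : HasDerivAt s s' t) (hu : HasDerivAt u u' t) :
    HasDerivAt (fun t => S.scl (s t) (u t)) (S.scl (s t) (s' • (S.r * u t) + u')) t := by
  refine hasDerivAt_pi.2 fun k => ?_
  have := ((hs.mul_const (S.r k)).exp).mul (hasDerivAt_pi.1 hu k)
  convert! this using 1
  simp [scl]; ring

lemma hasDerivAt_q_scl (x : ι → ℝ) (s : ℝ) :
    HasDerivAt (fun s => S.q (S.scl s x)) (2 * S.p (S.scl s x)) s := by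
  have h := S.hasDerivAt_q (S.hasDerivAt_scl (hasDerivAt_id s) (hasDerivAt_const s x))
  have e : S.scl s ((1 : ℝ) • (S.r * x) + 0) = S.r * S.scl s x := by
    ext k; simp [scl]; ring
  simp only [id, e] at h
  exact h

lemma strictMono_q_scl {x : ι → ℝ} (hx : x ≠ 0) : StrictMono fun s => S.q (S.scl s x) :=
  strictMono_of_hasDerivAt_pos (fun s => S.hasDerivAt_q_scl x s)
    fun _ => mul_pos two_pos (S.p_pos (S.scl_ne_zero hx))

lemma tendsto_scl_atBot (x : ι → ℝ) : Tendsto (fun s => S.scl s x) atBot (𝓝 0) := by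
  refine tendsto_pi_nhds.2 fun k => ?_
  have : Tendsto (fun s : ℝ => Real.exp (s * S.r k)) atBot (𝓝 0) :=
    Real.tendsto_exp_atBot.comp (tendsto_id.atBot_mul_const (S.r_pos k))
  simpa [scl] using this.mul_const (x k)

/-- All weights are positive, so `q` along a dilation orbit goes from `0` to `∞`: a single nonzero
coordinate already blows up. Monotonicity comes from `p > 0`. -/
lemma existsUnique_q_scl {x : ι → ℝ} (hx : x ≠ 0) : ∃! s, S.q (S.scl (-s) x) = 1 := by
  have hcont : Continuous fun s => S.q (S.scl s x) :=
    S.contDiff_q (n := 0).continuous.comp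
      (S.contDiff_scl (n := 0) contDiff_id contDiff_const).continuous
  have hbot : Tendsto (fun s => S.q (S.scl s x)) atBot (𝓝 0) := by
    have := (S.contDiff_q (n := 0)).continuous.tendsto 0
    rw [q_zero] at this
    exact this.comp (S.tendsto_scl_atBot x)
  obtain ⟨k, hk⟩ : ∃ k, x k ≠ 0 := by
    by_contra! h
    exact hx (funext h)
  obtain ⟨C, hC, hq⟩ := S.exists_norm_sq_le
  have htop : Tendsto (fun s => S.q (S.scl s x)) atTop atTop := by
    have h1 : Tendsto (fun s : ℝ => C⁻¹ * (Real.exp (s * S.r k) * |x k|) ^ 2) atTop atTop := by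
      refine Tendsto.const_mul_atTop (inv_pos.2 hC) ?_
      refine (tendsto_pow_atTop two_ne_zero).comp ?_
      exact (Real.tendsto_exp_atTop.comp
        (tendsto_id.atTop_mul_const (S.r_pos k))).atTop_mul_const (abs_pos.2 hk)
    refine tendsto_atTop_mono (fun s => ?_) h1
    rw [inv_mul_le_iff₀ hC]
    refine le_trans ?_ (hq _)
    have := norm_le_pi_norm (S.scl s x) k
    refine pow_le_pow_left₀ (by positivity) ?_ 2
    simpa [scl, abs_mul] using this
  obtain ⟨a, ha⟩ := (hbot.eventually_lt_const one_pos).exists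
  obtain ⟨b, hb⟩ := (htop.eventually_gt_atTop 1).exists
  obtain ⟨s, hs⟩ := mem_range_of_exists_le_of_exists_ge hcont ⟨a, ha.le⟩ ⟨b, hb.le⟩
  refine ⟨-s, by simpa using hs, fun t ht => ?_⟩
  have := (S.strictMono_q_scl hx).injective (ht.trans hs.symm)
  linarith

/-- The logarithm of the homogeneous norm. -/
def logNorm (x : ι → ℝ) : ℝ := Classical.epsilon fun s : ℝ => S.q (S.scl (-s) x) = 1

lemma q_scl_logNorm {x : ι → ℝ} (hx : x ≠ 0) : S.q (S.scl (-S.logNorm x) x) = 1 :=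
  Classical.epsilon_spec (S.existsUnique_q_scl hx).exists

lemma logNorm_eq {x : ι → ℝ} {s : ℝ} (h : S.q (S.scl (-s) x) = 1) : S.logNorm x = s := by
  have hx : x ≠ 0 := by
    rintro rfl
    simp at h
  exact (S.existsUnique_q_scl hx).unique (S.q_scl_logNorm hx) h

lemma logNorm_scl {x : ι → ℝ} (hx : S.q x = 1) (s : ℝ) : S.logNorm (S.scl s x) = s :=
  S.logNorm_eq (by simpa [scl_scl] using hx)

lemma logNorm_neg (x : ι → ℝ) : S.logNorm (-x) = S.logNorm x := by
  have : ∀ y, S.q (-y) = S.q y := fun y => by simpa using S.q_smul (-1) y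
  simp [logNorm, scl_neg_right, this]

lemma logNorm_lt_iff {x : ι → ℝ} (hx : x ≠ 0) {s : ℝ} :
    S.logNorm x < s ↔ S.q (S.scl (-s) x) < 1 := by
  rw [← S.q_scl_logNorm hx, (S.strictMono_q_scl hx).lt_iff_lt, neg_lt_neg_iff]

/-- Implicit function theorem for `q(d(-s)x) = 1`: the derivative in `s` is `-2p`, which does not
vanish. Uniqueness of the root identifies the implicit function with `logNorm`. -/
lemma contDiffAt_logNorm {x : ι → ℝ} (hx : x ≠ 0) : ContDiffAt ℝ 1 S.logNorm x := by
  set f : (ι → ℝ) × ℝ → ℝ := fun z => S.q (S.scl (-z.2) z.1) with hf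
  have hcd : ContDiff ℝ 1 f := S.contDiff_q.comp (S.contDiff_scl contDiff_snd.neg contDiff_fst)
  set u : (ι → ℝ) × ℝ := (x, S.logNorm x) with hu
  have hfu : f u = 1 := S.q_scl_logNorm hx
  have cdf : ContDiffAt ℝ 1 f u := hcd.contDiffAt
  have hd : (fderiv ℝ f u ∘L .inr ℝ (ι → ℝ) ℝ) 1 = -(2 * S.p (S.scl (-S.logNorm x) x)) := by
    have h1 : HasDerivAt (fun s : ℝ => f (x, s)) ((fderiv ℝ f u) (0, 1)) (S.logNorm x) :=
      (hcd.differentiable one_ne_zero u).hasFDerivAt.comp_hasDerivAt (S.logNorm x)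
        ((hasDerivAt_const _ x).prodMk (hasDerivAt_id _))
    have h2 := (S.hasDerivAt_q_scl x (-S.logNorm x)).scomp (S.logNorm x)
      (hasDerivAt_neg (S.logNorm x))
    have := h1.unique h2
    simpa using this
  have hne : -(2 * S.p (S.scl (-S.logNorm x) x)) ≠ 0 :=
    neg_ne_zero.2 (mul_pos two_pos (S.p_pos (S.scl_ne_zero hx))).ne'
  have inv : (fderiv ℝ f u ∘L .inr ℝ (ι → ℝ) ℝ).IsInvertible := by
    refine ⟨ContinuousLinearEquiv.unitsEquivAut ℝ (Units.mk0 _ hne), ?_⟩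
    ext
    simp only [← hd]
    simp
  have hev := cdf.eventually_apply_implicitFunction one_ne_zero inv
  refine (cdf.contDiffAt_implicitFunction one_ne_zero inv).congr_of_eventuallyEq ?_
  filter_upwards [hev] with y hy
  exact S.logNorm_eq (hy.trans hfu)

/-- Obtained by differentiating the identity `q(d(-σ(x))x) = 1` along the line `x + tv`. -/
lemma fderiv_logNorm {x : ι → ℝ} (hx : x ≠ 0) (v : ι → ℝ) :
    fderiv ℝ S.logNorm x v = (S.scl (-S.logNorm x) x ⬝ᵥ S.P *ᵥ S.scl (-S.logNorm x) v) /
      S.p (S.scl (-S.logNorm x) x) := by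
  have hline : HasDerivAt (fun t : ℝ => x + t • v) v 0 := by
    simpa using ((hasDerivAt_id (0 : ℝ)).smul_const v).const_add x
  have h0 : x + (0 : ℝ) • v = x := by simp
  have hσ : HasDerivAt (fun t : ℝ => S.logNorm (x + t • v)) (fderiv ℝ S.logNorm x v) 0 := by
    have := ((S.contDiffAt_logNorm hx).differentiableAt one_ne_zero).hasFDerivAt
    rw [← h0] at this
    have := this.comp_hasDerivAt (0 : ℝ) hline
    rwa [h0] at this
  have h1 := S.hasDerivAt_q (S.hasDerivAt_scl hσ.neg hline)
  have hev : (fun t : ℝ => S.q (S.scl (-S.logNorm (x + t • v)) (x + t • v))) =ᶠ[𝓝 0]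
      fun _ => 1 := by
    have : ∀ᶠ t : ℝ in 𝓝 0, x + t • v ≠ 0 :=
      hline.continuousAt.eventually_ne (by simpa using hx)
    filter_upwards [this] with t ht using S.q_scl_logNorm ht
  have h2 := h1.unique ((hasDerivAt_const (0 : ℝ) (1 : ℝ)).congr_of_eventuallyEq hev)
  simp only [h0, Pi.neg_apply] at h2
  rw [eq_div_iff (S.p_pos (S.scl_ne_zero hx)).ne', p]
  have h3 : S.scl (-S.logNorm x) (-(fderiv ℝ S.logNorm x v) • (S.r * x) + v) =
      -(fderiv ℝ S.logNorm x v) • (S.r * S.scl (-S.logNorm x) x) + S.scl (-S.logNorm x) v := by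
    ext k; simp [scl]; ring
  rw [h3, mulVec_add, dotProduct_add, mulVec_smul, dotProduct_smul] at h2
  simp only [smul_eq_mul] at h2
  linarith

end HomSystem

/-! ### The homogeneous field: decay, uniqueness and settling time -/

namespace HomSystem

variable {ι : Type*} [Fintype ι] (S : HomSystem ι)

lemma exists_logNorm_lt (s : ℝ) : ∀ᶠ x in 𝓝 0, x ≠ 0 → S.logNorm x < s := by
  have hc : Continuous fun x => S.q (S.scl (-s) x) :=
    S.contDiff_q (n := 0).continuous.comp
      (S.contDiff_scl (n := 0) contDiff_const contDiff_id).continuous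
  have := hc.tendsto 0
  simp only [scl_zero_right, q_zero] at this
  filter_upwards [this.eventually_lt_const one_pos] with x hx hne
  exact (S.logNorm_lt_iff hne).2 hx

lemma exists_forall_norm_lt {ε : ℝ} (hε : 0 < ε) :
    ∃ s, ∀ x, x ≠ 0 → S.logNorm x ≤ s → ‖x‖ < ε := by
  obtain ⟨C, hC, hq⟩ := S.exists_norm_sq_le
  have hev : ∀ᶠ s : ℝ in atBot, ∀ k, Real.exp (s * S.r k) * (C + 1) < ε := by
    refine eventually_all.2 fun k => ?_
    have : Tendsto (fun s : ℝ => Real.exp (s * S.r k) * (C + 1)) atBot (𝓝 (0 * (C + 1))) :=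
      (Real.tendsto_exp_atBot.comp (tendsto_id.atBot_mul_const (S.r_pos k))).mul_const _
    rw [zero_mul] at this
    exact this.eventually_lt_const hε
  obtain ⟨s, hs⟩ := hev.exists
  refine ⟨s, fun x hx hσ => (pi_norm_lt_iff hε).2 fun k => ?_⟩
  have hπ := hq (S.scl (-S.logNorm x) x)
  rw [S.q_scl_logNorm hx, mul_one] at hπ
  -- `C + 1` replaces `√C`, since `C ≤ (C + 1)²`.
  have hπ' : ‖S.scl (-S.logNorm x) x‖ ≤ C + 1 := by nlinarith [sq_nonneg (C + 1 : ℝ)]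
  have hk := (norm_le_pi_norm (S.scl (-S.logNorm x) x) k).trans hπ'
  have hx' : x k = Real.exp (S.logNorm x * S.r k) * S.scl (-S.logNorm x) x k := by
    rw [scl, ← mul_assoc, ← Real.exp_add]; simp
  refine lt_of_le_of_lt ?_ (hs k)
  rw [hx', norm_mul, Real.norm_eq_abs, Real.abs_exp]
  refine mul_le_mul (Real.exp_le_exp.2 ?_) hk (norm_nonneg _) (Real.exp_pos _).le
  exact mul_le_mul_of_nonneg_right hσ (S.r_pos k).le

/-- The homogeneous field. -/
def field (x : ι → ℝ) : ι → ℝ :=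
  Real.exp (S.μ * S.logNorm x) • S.scl (S.logNorm x) (S.M *ᵥ S.scl (-S.logNorm x) x)

-- `logNorm 0` is an arbitrary value, but it only acts on the zero vector.
@[simp] lemma field_zero : S.field 0 = 0 := by simp [field]

lemma field_neg (x : ι → ℝ) : S.field (-x) = -S.field x := by
  simp [field, logNorm_neg, scl_neg_right, mulVec_neg]

lemma field_scl {x : ι → ℝ} (hx : S.q x = 1) (s : ℝ) :
    S.field (S.scl s x) = Real.exp (S.μ * s) • S.scl s (S.M *ᵥ x) := by
  rw [field, S.logNorm_scl hx, scl_scl, neg_add_cancel, scl_zero_left]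

lemma contDiffAt_field {x : ι → ℝ} (hx : x ≠ 0) : ContDiffAt ℝ 1 S.field x := by
  have hσ := S.contDiffAt_logNorm hx
  refine (Real.contDiff_exp.contDiffAt.comp x (contDiffAt_const.mul hσ)).smul ?_
  have h1 : ContDiffAt ℝ 1 (fun x => S.scl (-S.logNorm x) x) x :=
    S.contDiff_scl_uncurry.contDiffAt.comp x (hσ.neg.prodMk contDiffAt_id)
  have h2 : ContDiffAt ℝ 1 (fun x => S.M *ᵥ S.scl (-S.logNorm x) x) x :=
    (contDiff_mulVec S.M contDiff_id).contDiffAt.comp x h1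
  exact S.contDiff_scl_uncurry.contDiffAt.comp x (hσ.prodMk h2)

lemma continuousAt_field {x : ι → ℝ} (hx : x ≠ 0) : ContinuousAt S.field x :=
  (S.contDiffAt_field hx).continuousAt

/-- The `k`-th component scales exactly like `e^{σ(μ + r k)}`, with a factor bounded on the
ellipsoid `q = 1`. The sign of `μ + r k` thus decides between continuity at the origin (positive)
and mere local boundedness (zero). -/
lemma exists_abs_field_le : ∃ R > 0, ∀ x, x ≠ 0 → ∀ k,
    |S.field x k| ≤ R * Real.exp (S.logNorm x * (S.μ + S.r k)) := by
  obtain ⟨C, hC, hq⟩ := exists_quadratic_le (Q₁ := fun x => ‖S.M *ᵥ x‖ ^ 2)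
    ((contDiff_mulVec (n := 0) S.M contDiff_id).continuous.norm.pow 2)
    (S.contDiff_q (n := 0)).continuous
    (fun c x => by rw [mulVec_smul, norm_smul, mul_pow, Real.norm_eq_abs, sq_abs]) S.q_smul
    fun _ => S.q_pos
  refine ⟨C + 1, by positivity, fun x hx k => ?_⟩
  have hπ := hq (S.scl (-S.logNorm x) x)
  rw [S.q_scl_logNorm hx, mul_one] at hπ
  have hπ' : ‖S.M *ᵥ S.scl (-S.logNorm x) x‖ ≤ C + 1 := by nlinarith [sq_nonneg (C + 1 : ℝ)]
  have hk := (norm_le_pi_norm (S.M *ᵥ S.scl (-S.logNorm x) x) k).trans hπ'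
  have : S.field x k = Real.exp (S.logNorm x * (S.μ + S.r k)) *
      (S.M *ᵥ S.scl (-S.logNorm x) x) k := by
    rw [mul_add, Real.exp_add, field, Pi.smul_apply, scl, smul_eq_mul, mul_assoc, mul_comm S.μ]
  rw [this, abs_mul, Real.abs_exp, mul_comm]
  exact mul_le_mul_of_nonneg_right hk (Real.exp_pos _).le

lemma continuousAt_field_zero (h : ∀ k, 0 < S.μ + S.r k) : ContinuousAt S.field 0 := by
  obtain ⟨R, hR, hb⟩ := S.exists_abs_field_le
  refine continuousAt_pi.2 fun k => ?_
  rw [ContinuousAt, field_zero, Pi.zero_apply, Metric.tendsto_nhds]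
  intro ε hε
  have : Tendsto (fun s : ℝ => R * Real.exp (s * (S.μ + S.r k))) atBot (𝓝 (R * 0)) :=
    (Real.tendsto_exp_atBot.comp (tendsto_id.atBot_mul_const (h k))).const_mul _
  rw [mul_zero] at this
  obtain ⟨s, hs⟩ := (this.eventually_lt_const hε).exists
  filter_upwards [S.exists_logNorm_lt s] with x hx
  rcases eq_or_ne x 0 with rfl | hne
  · simpa using hε
  rw [Real.dist_eq, sub_zero]
  refine (hb x hne k).trans_lt (lt_of_le_of_lt ?_ hs)
  gcongr
  · exact (h k).le
  · exact (hx hne).le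

lemma exists_norm_field_le (h : ∀ k, 0 ≤ S.μ + S.r k) (s : ℝ) :
    ∃ C ≥ 0, ∀ x, (x ≠ 0 → S.logNorm x ≤ s) → ‖S.field x‖ ≤ C := by
  obtain ⟨R, hR, hb⟩ := S.exists_abs_field_le
  have hC : 0 ≤ ∑ k, R * Real.exp (s * (S.μ + S.r k)) :=
    Finset.sum_nonneg fun k _ => by positivity
  refine ⟨_, hC, fun x hx => (pi_norm_le_iff_of_nonneg hC).2 fun k => ?_⟩
  rcases eq_or_ne x 0 with rfl | hne
  · simpa using hC
  refine (hb x hne k).trans (le_trans ?_ (Finset.single_le_sum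
    (f := fun k => R * Real.exp (s * (S.μ + S.r k))) (fun k _ => by positivity)
    (Finset.mem_univ k)))
  have := h k
  have := hx hne
  gcongr

/-- Solutions of the field away from the origin, with no condition at the origin but continuity. -/
def IsWeakSolutionOn (y : ℝ → ι → ℝ) (J : Set ℝ) : Prop :=
  ContinuousOn y J ∧ ∀ t ∈ J, y t ≠ 0 → HasDerivWithinAt y (S.field (y t)) J t

variable {S}

lemma IsWeakSolutionOn.mono {y : ℝ → ι → ℝ} {J J' : Set ℝ} (h : S.IsWeakSolutionOn y J)
    (hJ : J' ⊆ J) : S.IsWeakSolutionOn y J' :=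
  ⟨h.1.mono hJ, fun t ht hne => (h.2 t (hJ ht) hne).mono hJ⟩

/-- The outer dilation in the field cancels, so only the angular position and the factor `e^{μσ}`
remain. -/
lemma hasDerivAt_logNorm {y : ℝ → ι → ℝ} {t : ℝ} (hy : HasDerivAt y (S.field (y t)) t)
    (hne : y t ≠ 0) : HasDerivAt (fun t => S.logNorm (y t))
      (-(Real.exp (S.μ * S.logNorm (y t)) * (S.m (S.scl (-S.logNorm (y t)) (y t)) /
        S.p (S.scl (-S.logNorm (y t)) (y t))))) t := by
  have h := ((S.contDiffAt_logNorm hne).differentiableAt one_ne_zero).hasFDerivAt.comp_hasDerivAt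
    t hy
  convert! h using 1
  rw [S.fderiv_logNorm hne]
  have : S.scl (-S.logNorm (y t)) (S.field (y t)) =
      Real.exp (S.μ * S.logNorm (y t)) • S.M *ᵥ S.scl (-S.logNorm (y t)) (y t) := by
    rw [field, scl_smul_right, scl_scl, neg_add_cancel, scl_zero_left]
  rw [this, mulVec_smul, dotProduct_smul, smul_eq_mul, m]
  ring

namespace IsWeakSolutionOn

lemma hasDerivAt {y : ℝ → ι → ℝ} {a b t : ℝ} (h : S.IsWeakSolutionOn y (Icc a b))
    (ht : t ∈ Ioo a b) (hne : y t ≠ 0) : HasDerivAt y (S.field (y t)) t :=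
  (h.2 t (Ioo_subset_Icc_self ht) hne).hasDerivAt (Icc_mem_nhds ht.1 ht.2)

lemma continuousOn_logNorm {y : ℝ → ι → ℝ} {J : Set ℝ} (h : S.IsWeakSolutionOn y J)
    (hne : ∀ t ∈ J, y t ≠ 0) : ContinuousOn (fun t => S.logNorm (y t)) J := fun t ht =>
  (S.contDiffAt_logNorm (hne t ht)).continuousAt.comp_continuousWithinAt (h.1 t ht)

lemma logNorm_le_of_forall_ne {y : ℝ → ι → ℝ} {a b : ℝ} (hab : a ≤ b)
    (h : S.IsWeakSolutionOn y (Icc a b)) (hne : ∀ t ∈ Icc a b, y t ≠ 0) :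
    S.logNorm (y b) ≤ S.logNorm (y a) := by
  have hd : ∀ t ∈ interior (Icc a b), HasDerivAt (fun t => S.logNorm (y t)) _ t := fun t ht => by
    rw [interior_Icc] at ht
    exact hasDerivAt_logNorm (h.hasDerivAt ht (hne t (Ioo_subset_Icc_self ht)))
      (hne t (Ioo_subset_Icc_self ht))
  refine antitoneOn_of_deriv_nonpos (convex_Icc a b) (h.continuousOn_logNorm hne)
    (fun t ht => (hd t ht).differentiableAt.differentiableWithinAt) (fun t ht => ?_)
    (left_mem_Icc.2 hab) (right_mem_Icc.2 hab) hab
  rw [(hd t ht).deriv]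
  have hz := S.scl_ne_zero (s := -S.logNorm (y t)) (hne t (interior_subset ht))
  exact neg_nonpos.2 (mul_nonneg (Real.exp_pos _).le
    (div_nonneg (S.m_pos hz).le (S.p_pos hz).le))

/-- After the last zero `c` before `b`, `logNorm` is nonincreasing, so it stays above its value at
`b`; yet it tends to `-∞` as time decreases to `c`. -/
lemma forall_ne_zero {y : ℝ → ι → ℝ} {a b : ℝ} (h : S.IsWeakSolutionOn y (Icc a b))
    (hb : y b ≠ 0) : ∀ t ∈ Icc a b, y t ≠ 0 := by
  by_contra! hcon
  obtain ⟨t₀, ht₀, hy₀⟩ := hcon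
  set D : Set ℝ := Icc a b ∩ y ⁻¹' {0} with hD
  have hDc : IsCompact D := isCompact_Icc.of_isClosed_subset
    (h.1.preimage_isClosed_of_isClosed isClosed_Icc isClosed_singleton) inter_subset_left
  obtain ⟨c, hcD, hmax⟩ := hDc.exists_isGreatest ⟨t₀, ht₀, hy₀⟩
  have hyc : y c = 0 := hcD.2
  have hcb : c < b := lt_of_le_of_ne hcD.1.2 fun e => hb (e ▸ hyc)
  have hne : ∀ t ∈ Ioc c b, y t ≠ 0 := fun t ht e =>
    not_lt.2 (hmax ⟨⟨hcD.1.1.trans ht.1.le, ht.2⟩, e⟩) ht.1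
  have hcont : Tendsto y (𝓝[Ioc c b] c) (𝓝 0) := by
    have := (h.1 c hcD.1).mono_left
      (nhdsWithin_mono c (Ioc_subset_Icc_self.trans (Icc_subset_Icc_left hcD.1.1)))
    rwa [hyc] at this
  have hbot : NeBot (𝓝[Ioc c b] c) := by
    rw [nhdsWithin_Ioc_eq_nhdsGT hcb]; infer_instance
  obtain ⟨t, ht, htm⟩ := ((hcont.eventually (S.exists_logNorm_lt (S.logNorm (y b)))).and
    self_mem_nhdsWithin).exists
  have hsub : Icc t b ⊆ Icc a b := Icc_subset_Icc_left (hcD.1.1.trans htm.1.le)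
  have := (h.mono hsub).logNorm_le_of_forall_ne htm.2 fun u hu => hne u ⟨htm.1.trans_le hu.1, hu.2⟩
  exact not_lt.2 this (ht (hne t htm))

lemma logNorm_le {y : ℝ → ι → ℝ} {a b : ℝ} (hab : a ≤ b)
    (h : S.IsWeakSolutionOn y (Icc a b)) (hb : y b ≠ 0) :
    S.logNorm (y b) ≤ S.logNorm (y a) :=
  h.logNorm_le_of_forall_ne hab (h.forall_ne_zero hb)

/-- Consider the last time `a` of agreement. If the common value is the origin, both curves remain
there; otherwise the field is locally Lipschitz and agreement extends beyond `a`. -/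
theorem eq_of_initial_eq {y z : ℝ → ι → ℝ} {b : ℝ} (hb : 0 ≤ b)
    (hy : S.IsWeakSolutionOn y (Icc 0 b)) (hz : S.IsWeakSolutionOn z (Icc 0 b)) (h0 : y 0 = z 0) :
    y b = z b := by
  by_contra hbne
  set D : Set ℝ := Icc 0 b ∩ (fun t => y t - z t) ⁻¹' {0} with hD
  have hDc : IsCompact D := isCompact_Icc.of_isClosed_subset
    ((hy.1.sub hz.1).preimage_isClosed_of_isClosed isClosed_Icc isClosed_singleton)
    inter_subset_left
  obtain ⟨a, haD, hmax⟩ := hDc.exists_isGreatest ⟨0, left_mem_Icc.2 hb, by simp [h0]⟩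
  have hya : y a = z a := sub_eq_zero.1 haD.2
  have hab : a < b := lt_of_le_of_ne haD.1.2 fun e => hbne (e ▸ hya)
  have hsub : Icc a b ⊆ Icc 0 b := Icc_subset_Icc_left haD.1.1
  have hna : y a ≠ 0 := by
    intro hzero
    have h1 : y b = 0 := by
      by_contra hc
      exact (hy.mono hsub).forall_ne_zero hc a (left_mem_Icc.2 hab.le) hzero
    have h2 : z b = 0 := by
      by_contra hc
      exact (hz.mono hsub).forall_ne_zero hc a (left_mem_Icc.2 hab.le) (hya ▸ hzero)
    exact hbne (h1.trans h2.symm)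
  obtain ⟨K, s, hs, hL⟩ := (S.contDiffAt_field hna).exists_lipschitzOnWith
  have hs' : s ∩ {0}ᶜ ∈ 𝓝 (y a) := inter_mem hs (isOpen_compl_singleton.mem_nhds hna)
  have e1 : ∀ᶠ t in 𝓝[>] a, y t ∈ s ∩ {0}ᶜ := by
    rw [← nhdsWithin_Ioc_eq_nhdsGT hab]
    exact ((hy.1 a haD.1).mono (Ioc_subset_Icc_self.trans hsub)) hs'
  have e2 : ∀ᶠ t in 𝓝[>] a, z t ∈ s ∩ {0}ᶜ := by
    rw [← nhdsWithin_Ioc_eq_nhdsGT hab]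
    exact ((hz.1 a haD.1).mono (Ioc_subset_Icc_self.trans hsub)) (hya ▸ hs')
  obtain ⟨c', hc', hcs⟩ := mem_nhdsGT_iff_exists_Ioc_subset.1 (e1.and e2)
  set c := min c' b with hc
  have hac : a < c := lt_min hc' hab
  have hmem : ∀ t ∈ Icc a c, y t ∈ s ∩ {0}ᶜ ∧ z t ∈ s ∩ {0}ᶜ := by
    intro t ht
    rcases ht.1.eq_or_lt with rfl | hlt
    · exact ⟨mem_of_mem_nhds hs', hya ▸ mem_of_mem_nhds hs'⟩
    · exact hcs ⟨hlt, ht.2.trans (min_le_left _ _)⟩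
  have hcb : Icc a c ⊆ Icc 0 b := (Icc_subset_Icc_right (min_le_right _ _)).trans hsub
  have hIci : ∀ t ∈ Ico a c, Icc 0 b ∈ 𝓝[≥] t := fun t ht =>
    mem_of_superset (Icc_mem_nhdsGE (ht.2.trans_le (min_le_right c' b)))
      (Icc_subset_Icc_left (haD.1.1.trans ht.1))
  have huniq := ODE_solution_unique_of_mem_Icc_right (v := fun _ => S.field) (s := fun _ => s)
    (K := K) (fun _ _ => hL) (hy.1.mono hcb)
    (fun t ht => (hy.2 t (hcb (Ico_subset_Icc_self ht))
      (hmem t (Ico_subset_Icc_self ht)).1.2).mono_of_mem_nhdsWithin (hIci t ht))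
    (fun t ht => (hmem t (Ico_subset_Icc_self ht)).1.1) (hz.1.mono hcb)
    (fun t ht => (hz.2 t (hcb (Ico_subset_Icc_self ht))
      (hmem t (Ico_subset_Icc_self ht)).2.2).mono_of_mem_nhdsWithin (hIci t ht))
    (fun t ht => (hmem t (Ico_subset_Icc_self ht)).2.1) hya
  have hcc := huniq (right_mem_Icc.2 hac.le)
  exact not_lt.2 (hmax ⟨hcb (right_mem_Icc.2 hac.le), sub_eq_zero.2 hcc⟩) hac

end IsWeakSolutionOn

variable (S) in
-- With `c` a lower bound of `m/p`, the derivative of `e^{-μσ}` is at most `μc < 0`. This positive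
-- quantity cannot survive beyond its initial value divided by `-μc`.
theorem exists_settlingTime (hμ : S.μ < 0) : ∃ T : (ι → ℝ) → ℝ, (∀ x, 0 < T x) ∧
    ∀ y t, 0 ≤ t → S.IsWeakSolutionOn y (Icc 0 t) → T (y 0) ≤ t → y t = 0 := by
  obtain ⟨c, hc, hpm⟩ := S.exists_p_le_m
  have hμc : 0 < -S.μ * c := mul_pos (neg_pos.2 hμ) hc
  refine ⟨fun x => Real.exp (-S.μ * S.logNorm x) / (-S.μ * c), fun x => by positivity,
    fun y t ht0 hy' ht => ?_⟩
  by_contra hne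
  have hnz := hy'.forall_ne_zero hne
  have hd : ∀ u ∈ interior (Icc 0 t),
      HasDerivAt (fun t => Real.exp (-S.μ * S.logNorm (y t)))
        (S.μ * (S.m (S.scl (-S.logNorm (y u)) (y u)) /
        S.p (S.scl (-S.logNorm (y u)) (y u)))) u := fun u hu => by
    rw [interior_Icc] at hu
    have hu' := hnz u (Ioo_subset_Icc_self hu)
    have h1 := ((hasDerivAt_logNorm (hy'.hasDerivAt hu hu') hu').const_mul (-S.μ)).exp
    convert! h1 using 1
    have : Real.exp (-S.μ * S.logNorm (y u)) * Real.exp (S.μ * S.logNorm (y u)) = 1 := by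
      rw [← Real.exp_add]; simp
    linear_combination (-S.μ * (S.m (S.scl (-S.logNorm (y u)) (y u)) /
        S.p (S.scl (-S.logNorm (y u)) (y u)))) * this
  have hle := Convex.image_sub_le_mul_sub_of_deriv_le (convex_Icc 0 t)
    (f := fun t => Real.exp (-S.μ * S.logNorm (y t)))
    (Real.continuous_exp.comp_continuousOn
      (continuousOn_const.mul (hy'.continuousOn_logNorm hnz)))
    (fun u hu => (hd u hu).differentiableAt.differentiableWithinAt) (C := S.μ * c)
    (fun u hu => by
      rw [(hd u hu).deriv]
      have hz := S.scl_ne_zero (s := -S.logNorm (y u)) (hnz u (interior_subset hu))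
      refine mul_le_mul_of_nonpos_left ?_ hμ.le
      rw [le_div_iff₀ (S.p_pos hz)]
      exact hpm _) 0 (left_mem_Icc.2 ht0) t (right_mem_Icc.2 ht0) ht0
  have hpos := Real.exp_pos (-S.μ * S.logNorm (y t))
  rw [div_le_iff₀ hμc] at ht
  nlinarith

variable (S) in
theorem exists_forall_norm_lt_of_initial {ε : ℝ} (hε : 0 < ε) : ∃ δ > 0, ∀ y t,
    0 ≤ t → S.IsWeakSolutionOn y (Icc 0 t) → ‖y 0‖ < δ → ‖y t‖ < ε := by
  obtain ⟨s, hs⟩ := S.exists_forall_norm_lt hε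
  obtain ⟨δ, hδ, h⟩ := Metric.eventually_nhds_iff.1 (S.exists_logNorm_lt s)
  refine ⟨δ, hδ, fun y t ht hy' h0 => ?_⟩
  rcases eq_or_ne (y t) 0 with hz | hne
  · simpa [hz] using hε
  refine hs _ hne ((hy'.logNorm_le ht hne).trans (h ?_ ?_).le)
  · simpa using h0
  · exact hy'.forall_ne_zero hne 0 (left_mem_Icc.2 ht)

end HomSystem

/-! ### Existence of trajectories -/

lemma exists_integralCurve_of_hasCompactSupport {E : Type*} [NormedAddCommGroup E]
    [NormedSpace ℝ E] [CompleteSpace E] {v : E → E} (hv : ContDiff ℝ 1 v)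
    (hc : HasCompactSupport v) (x : E) :
    ∃ γ : ℝ → E, γ 0 = x ∧ ∀ t, HasDerivAt γ (v (γ t)) t := by
  obtain ⟨K, hK⟩ := hv.lipschitzWith_of_hasCompactSupport hc one_ne_zero
  obtain ⟨L, hL⟩ := hc.exists_bound_of_continuous hv.continuous
  have key : ∀ a : ℝ, ∃ γ : ℝ → E, 0 < a → γ 0 = x ∧
      ∀ t ∈ Ioo (-a) a, HasDerivAt γ (v (γ t)) t := by
    intro a
    rcases le_or_gt a 0 with ha | ha
    · exact ⟨0, fun h => absurd h (not_lt.2 ha)⟩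
    have hL0 : 0 ≤ L := (norm_nonneg _).trans (hL x)
    have h : IsPicardLindelof (fun _ => v) (tmin := -a) (tmax := a)
        -- The speed is at most `L`, so no curve leaves the ball of radius `L * a` within time `a`;
        -- hence every interval length is admissible.
        ⟨0, by constructor <;> linarith⟩ x (L.toNNReal * a.toNNReal) 0 L.toNNReal K :=
      { lipschitzOnWith := fun _ _ => hK.lipschitzOnWith
        continuousOn := fun _ _ => continuousOn_const
        norm_le := fun _ _ y _ => by simpa [hL0] using hL y
        mul_max_le := by simp [hL0, ha.le] }
    obtain ⟨γ, h0, hγ⟩ := h.exists_eq_forall_mem_Icc_hasDerivWithinAt₀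
    exact ⟨γ, fun _ => ⟨h0, fun t ht =>
      (hγ t (Ioo_subset_Icc_self ht)).hasDerivAt (Icc_mem_nhds ht.1 ht.2)⟩⟩
  choose γ hγ using key
  have agree : ∀ {a b : ℝ}, 0 < a → a ≤ b → EqOn (γ a) (γ b) (Ioo (-a) a) := by
    intro a b ha hab
    refine ODE_solution_unique_of_mem_Ioo (v := fun _ => v) (s := fun _ => univ) (K := K)
      (t₀ := 0) (fun _ _ => hK.lipschitzOnWith) ⟨by linarith, ha⟩
      (fun t ht => ⟨(hγ a ha).2 t ht, mem_univ _⟩)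
      (fun t ht => ⟨(hγ b (ha.trans_le hab)).2 t ⟨by linarith [ht.1], by linarith [ht.2]⟩,
        mem_univ _⟩) ?_
    rw [(hγ a ha).1, (hγ b (ha.trans_le hab)).1]
  -- The interval of half-length `|t| + 1` has `t` in its interior, and the local curves agree where
  -- they overlap.
  refine ⟨fun t => γ (|t| + 1) t, (hγ _ (by positivity)).1, fun t => ?_⟩
  have hpos : ∀ u : ℝ, 0 < |u| + 1 := fun u => by positivity
  have hmem : ∀ u : ℝ, u ∈ Ioo (-(|u| + 1)) (|u| + 1) := fun u => abs_lt.1 (lt_add_one _)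
  refine ((hγ _ (hpos t)).2 t (hmem t)).congr_of_eventuallyEq ?_
  filter_upwards [Ioo_mem_nhds (hmem t).1 (hmem t).2] with u hu
  rcases le_total (|t| + 1) (|u| + 1) with h | h
  · exact (agree (hpos t) h hu).symm
  · exact agree (hpos u) h (hmem u)

namespace HomSystem

variable {ι : Type*} [Fintype ι] (S : HomSystem ι)

/-- The angular part of the field, in a time in which it is a polynomial and preserves `q`. -/
lemma exists_angular_curve {x : ι → ℝ} (hx : S.q x = 1) : ∃ γ : ℝ → ι → ℝ, γ 0 = x ∧
    (∀ t, S.q (γ t) = 1) ∧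
    ∀ t, HasDerivAt γ (S.p (γ t) • S.M *ᵥ γ t + S.m (γ t) • (S.r * γ t)) t := by
  obtain ⟨C, hC, hq⟩ := S.exists_norm_sq_le
  -- The cutoff makes the field compactly supported. Being a scalar factor it does not spoil the
  -- conservation of `q`, so the curve stays on `q = 1`, where `φ = 1`.
  let φ : ContDiffBump (0 : ι → ℝ) := ⟨C + 1, C + 2, by linarith, by linarith⟩
  let F : (ι → ℝ) → ι → ℝ := fun y => S.p y • S.M *ᵥ y + S.m y • (S.r * y)
  have hF : ContDiff ℝ 1 F := (S.contDiff_p.smul (contDiff_mulVec _ contDiff_id)).add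
    (S.contDiff_m.smul (S.contDiff_weight_mul contDiff_id))
  obtain ⟨γ, h0, hγ⟩ := exists_integralCurve_of_hasCompactSupport
    (v := fun y => φ y • F y) (φ.contDiff.smul hF) φ.hasCompactSupport.smul_right x
  have hzero : ∀ t, HasDerivAt (fun t => S.q (γ t)) 0 t := by
    intro t
    convert! S.hasDerivAt_q (hγ t) using 1
    simp only [F, mulVec_smul, mulVec_add, dotProduct_smul, dotProduct_add, smul_eq_mul]
    have h1 : γ t ⬝ᵥ S.P *ᵥ (S.M *ᵥ γ t) = -S.m (γ t) := by simp [m]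
    have h2 : γ t ⬝ᵥ S.P *ᵥ (S.r * γ t) = S.p (γ t) := rfl
    rw [h1, h2]; ring
  have hq1 : ∀ t, S.q (γ t) = 1 := fun t => by
    rw [is_const_of_deriv_eq_zero (f := fun t => S.q (γ t)) (fun t => (hzero t).differentiableAt)
      (fun t => (hzero t).deriv) t 0, h0, hx]
  refine ⟨γ, h0, hq1, fun t => ?_⟩
  have hb : φ (γ t) = 1 := by
    refine φ.one_of_mem_closedBall ?_
    rw [mem_closedBall_zero_iff]
    have := hq (γ t)
    rw [hq1 t] at this
    change ‖γ t‖ ≤ C + 1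
    nlinarith [norm_nonneg (γ t)]
  have := hγ t
  simp only [hb, one_smul] at this
  exact this

/-- The field has a global trajectory after a change of time. -/
lemma exists_reparametrized_curve {x : ι → ℝ} (hx : x ≠ 0) :
    ∃ (γ : ℝ → ι → ℝ) (w : ℝ → ℝ), γ 0 = x ∧ Continuous w ∧ (∀ t, 0 < w t) ∧
      (∀ t, γ t ≠ 0) ∧ (∀ t, HasDerivAt γ (w t • S.field (γ t)) t) ∧
      Antitone (fun t => S.logNorm (γ t)) ∧ Tendsto (fun t => S.logNorm (γ t)) atTop atBot := by
  obtain ⟨π, h0, hq, hπ⟩ := S.exists_angular_curve (S.q_scl_logNorm hx)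
  have hπc : Continuous π := continuous_iff_continuousAt.2 fun t => (hπ t).continuousAt
  have hmc : Continuous fun t => S.m (π t) := (S.contDiff_m (n := 0)).continuous.comp hπc
  -- The choice `s' = -m` cancels the correction `m • (r * π)` that keeps `π` on the ellipsoid; what
  -- is left is a positive multiple of the field.
  set s : ℝ → ℝ := fun t => S.logNorm x - ∫ u in (0 : ℝ)..t, S.m (π u) with hs
  have hsd : ∀ t, HasDerivAt s (-S.m (π t)) t := fun t =>
    (hmc.integral_hasStrictDerivAt 0 t).hasDerivAt.const_sub _
  have hsc : Continuous s := continuous_iff_continuousAt.2 fun t => (hsd t).continuousAt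
  have hne : ∀ t, π t ≠ 0 := fun t => S.ne_zero_of_q (hq t)
  have hlog : ∀ t, S.logNorm (S.scl (s t) (π t)) = s t := fun t => S.logNorm_scl (hq t) _
  obtain ⟨c, hc, hcm⟩ := S.exists_q_le_m
  refine ⟨fun t => S.scl (s t) (π t), fun t => Real.exp (-(S.μ * s t)) * S.p (π t), ?_, ?_,
    fun t => mul_pos (Real.exp_pos _) (S.p_pos (hne t)), fun t => S.scl_ne_zero (hne t),
    fun t => ?_, ?_, ?_⟩
  · simp [hs, h0, scl_scl]
  · exact (Real.continuous_exp.comp (continuous_const.mul hsc).neg).mul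
      ((S.contDiff_p (n := 0)).continuous.comp hπc)
  · have := S.hasDerivAt_scl (hsd t) (hπ t)
    convert! this using 1
    rw [S.field_scl (hq t), smul_smul, mul_right_comm, ← Real.exp_add, neg_add_cancel,
      Real.exp_zero, one_mul, ← S.scl_smul_right]
    congr 1
    rw [neg_smul]
    abel
  · simp only [hlog]
    exact antitone_of_deriv_nonpos (fun t => (hsd t).differentiableAt)
      fun t => by rw [(hsd t).deriv]; exact (neg_neg_of_pos (S.m_pos (hne t))).le
  · simp only [hlog]
    have hle : ∀ t, 0 ≤ t → s t ≤ s 0 + -c * t := fun t ht => by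
      have := image_sub_le_mul_sub_of_deriv_le (f := s) (C := -c)
        (fun t => (hsd t).differentiableAt)
        (fun t => by rw [(hsd t).deriv]; have := hcm (π t); rw [hq] at this; linarith) ht
      linarith
    refine tendsto_atBot_mono' atTop ?_ (tendsto_atBot_add_const_left _ (s 0)
      (tendsto_id.const_mul_atTop_of_neg (neg_neg_of_pos hc)))
    filter_upwards [eventually_ge_atTop 0] with t ht using hle t ht

/-- From every initial state there is a solution; it has a right derivative everywhere and is
differentiable except possibly at the time at which it reaches the origin. -/
theorem exists_solution (x : ι → ℝ) : ∃ (y : ℝ → ι → ℝ) (Z : Set ℝ), y 0 = x ∧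
    Z.Subsingleton ∧ (∀ t ∈ Z, y t = 0) ∧ (∀ t, 0 ≤ t → ContinuousAt y t) ∧
    (∀ t, 0 ≤ t → HasDerivWithinAt y (S.field (y t)) (Ici t) t) ∧
    ∀ t, 0 ≤ t → t ∉ Z → HasDerivAt y (S.field (y t)) t := by
  rcases eq_or_ne x 0 with rfl | hx
  · refine ⟨fun _ => 0, ∅, rfl, subsingleton_empty, fun _ _ => rfl,
      fun _ _ => continuousAt_const, fun t _ => ?_, fun t _ _ => ?_⟩
    · simpa using hasDerivWithinAt_const t _ (0 : ι → ℝ)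
    · simpa using hasDerivAt_const t (0 : ι → ℝ)
  obtain ⟨γ, w, h0, hw, hwpos, hne, hγ, hanti, hlim⟩ := S.exists_reparametrized_curve hx
  set τ : ℝ → ℝ := fun t => ∫ u in (0 : ℝ)..t, w u with hτ
  have hτd : ∀ t, HasStrictDerivAt τ (w t) t := fun t => hw.integral_hasStrictDerivAt 0 t
  have hτc : Continuous τ := continuous_iff_continuousAt.2 fun t => (hτd t).hasDerivAt.continuousAt
  have hmono : StrictMono τ := strictMono_of_hasDerivAt_pos (fun t => (hτd t).hasDerivAt) hwpos
  have hE : IsOpenEmbedding τ := IsOpenEmbedding.of_continuous_injective_isOpenMap hτc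
    hmono.injective (isOpenMap_of_hasStrictDerivAt hτd fun t => (hwpos t).ne')
  have hτ0 : τ 0 = 0 := by simp [hτ]
  set e := hE.toOpenPartialHomeomorph τ with he
  have hetarget : e.target = range τ := by simp [he]
  have hleft : ∀ t, e.symm (τ t) = t := fun t => e.left_inv (by simp [he])
  have hdown : ∀ {u v : ℝ}, 0 ≤ u → u ≤ v → v ∈ range τ → u ∈ range τ := by
    rintro u v hu huv ⟨t, rfl⟩
    exact mem_range_of_exists_le_of_exists_ge hτc ⟨0, hτ0.trans_le hu⟩ ⟨t, huv⟩
  classical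
  -- No case split on the degree is needed: if the new time `τ` is bounded above, the curve is
  -- continued by zero.
  set y : ℝ → ι → ℝ := fun u => if u ∈ range τ then γ (e.symm u) else 0 with hy
  have hyin : ∀ t, y (τ t) = γ t := fun t => by simp [hy, hleft]
  have hyout : ∀ u, u ∉ range τ → y u = 0 := fun u hu => by simp only [hy, if_neg hu]
  -- At most one point: the first nonnegative time outside the range of `τ`, that is, the arrival at
  -- the origin.
  set Z : Set ℝ := {u | u ∉ range τ ∧ 0 ≤ u ∧ ∀ v, 0 ≤ v → v < u → v ∈ range τ} with hZ
  have hin : ∀ u ∈ range τ, HasDerivAt y (S.field (y u)) u := by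
    rintro u ⟨t, rfl⟩
    have hsymm : HasDerivAt e.symm (w t)⁻¹ (τ t) := by
      refine e.hasDerivAt_symm (by simp [hetarget]) (hwpos t).ne' ?_
      rw [hleft]
      exact (hτd t).hasDerivAt
    have h1 : HasDerivAt γ (w t • S.field (γ t)) (e.symm (τ t)) := by
      rw [hleft]; exact hγ t
    have h2 := h1.scomp (τ t) hsymm
    rw [smul_smul, inv_mul_cancel₀ (hwpos t).ne', one_smul] at h2
    rw [hyin]
    refine h2.congr_of_eventuallyEq ?_
    filter_upwards [hE.isOpen_range.mem_nhds (mem_range_self t)] with u hu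
    simp only [hy, if_pos hu, Function.comp]
  have hzero_after : ∀ {u v : ℝ}, 0 ≤ u → u ∉ range τ → u ≤ v → y v = 0 := fun hu hur huv =>
    hyout _ fun hv => hur (hdown hu huv hv)
  have hout : ∀ u, 0 ≤ u → u ∉ range τ → u ∉ Z → HasDerivAt y (S.field (y u)) u := by
    intro u hu hur huZ
    obtain ⟨v, hv, hvu, hvr⟩ : ∃ v, 0 ≤ v ∧ v < u ∧ v ∉ range τ := by
      by_contra! hcon
      exact huZ ⟨hur, hu, hcon⟩
    rw [hyout u hur, field_zero]
    refine (hasDerivAt_const u (0 : ι → ℝ)).congr_of_eventuallyEq ?_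
    filter_upwards [Ioi_mem_nhds hvu] with a ha using hzero_after hv hvr (le_of_lt ha)
  have hZc : ∀ u ∈ Z, ContinuousAt y u := by
    rintro u ⟨hur, hu, -⟩
    rw [ContinuousAt, hyout u hur, Metric.tendsto_nhds]
    intro ε hε
    obtain ⟨s, hs⟩ := S.exists_forall_norm_lt hε
    obtain ⟨t, ht⟩ := (hlim.eventually_le_atBot s).exists
    have htu : τ t < u := by
      by_contra! hcon
      exact hur (hdown hu hcon (mem_range_self t))
    filter_upwards [Ioi_mem_nhds htu] with a ha
    rw [dist_zero_right]
    by_cases har : a ∈ range τ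
    · obtain ⟨b, rfl⟩ := har
      rw [hyin]
      exact hs _ (hne b) ((hanti (hmono.lt_iff_lt.1 ha).le).trans ht)
    · rw [hyout a har, norm_zero]
      exact hε
  refine ⟨y, Z, ?_, ?_, fun t ht => hyout t ht.1, fun t ht => ?_, fun t ht => ?_,
    fun t ht htZ => ?_⟩
  · rw [← hτ0, hyin, h0]
  · intro u hu v hv
    rcases lt_trichotomy u v with h | h | h
    · exact absurd (hv.2.2 u hu.2.1 h) hu.1
    · exact h
    · exact absurd (hu.2.2 v hv.2.1 h) hv.1
  · by_cases h : t ∈ Z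
    · exact hZc t h
    · by_cases hr : t ∈ range τ
      · exact (hin t hr).continuousAt
      · exact (hout t ht hr h).continuousAt
  · by_cases hr : t ∈ range τ
    · exact (hin t hr).hasDerivWithinAt
    · rw [hyout t hr, field_zero]
      exact (hasDerivWithinAt_const t (Ici t) (0 : ι → ℝ)).congr
        (fun u hu => hzero_after ht hr hu) (hyout t hr)
  · by_cases hr : t ∈ range τ
    · exact hin t hr
    · exact hout t ht hr htZ

end HomSystem

/-! ### Weak, classical and Filippov solutions of the product system -/

/-- Near `t₀` the curve avoids the origin, so `g ∘ y` is continuous and has a `C¹` primitive. Its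
difference from `y` is absolutely continuous with derivative zero almost everywhere, hence constant.
-/
lemma hasDerivWithinAt_of_absolutelyContinuous {E : Type*} [NormedAddCommGroup E]
    [NormedSpace ℝ E] [CompleteSpace E] {g : E → E} (hg : ∀ x, x ≠ 0 → ContinuousAt g x)
    {y : ℝ → E} {a b : ℝ} (hab : a ≤ b) (hac : AbsolutelyContinuousOnInterval y a b)
    (hd : ∀ᵐ t, t ∈ Icc a b → y t ≠ 0 → HasDerivAt y (g (y t)) t)
    {t₀ : ℝ} (ht₀ : t₀ ∈ Icc a b) (hne : y t₀ ≠ 0) :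
    HasDerivWithinAt y (g (y t₀)) (Icc a b) t₀ := by
  have hyc : ContinuousOn y (Icc a b) := by simpa [uIcc_of_le hab] using hac.continuousOn
  obtain ⟨ε, hε, hball⟩ := Metric.mem_nhdsWithin_iff.1
    ((hyc t₀ ht₀).eventually_ne hne)
  set c := max a (t₀ - ε / 2) with hc
  set d := min b (t₀ + ε / 2) with hd'
  have hct : c ≤ t₀ := max_le ht₀.1 (by linarith)
  have htd : t₀ ≤ d := le_min ht₀.2 (by linarith)
  have hcd : c ≤ d := hct.trans htd
  have hsub : Icc c d ⊆ Icc a b := Icc_subset_Icc (le_max_left _ _) (min_le_left _ _)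
  have hnz : ∀ t ∈ Icc c d, y t ≠ 0 := fun t ht => hball ⟨by
    rw [Metric.mem_ball, Real.dist_eq, abs_lt]
    have h1 := (le_max_right a (t₀ - ε / 2)).trans ht.1
    have h2 := ht.2.trans (min_le_right b (t₀ + ε / 2))
    constructor <;> linarith, hsub ht⟩
  have hh : ContinuousOn (fun t => g (y t)) (Icc c d) := fun t ht =>
    (hg _ (hnz t ht)).comp_continuousWithinAt ((hyc.mono hsub) t ht)
  set h : ℝ → E := IccExtend hcd ((Icc c d).domRestrict fun t => g (y t)) with hhdef
  have hhc : Continuous h := (continuousOn_iff_continuous_domRestrict.1 hh).Icc_extend'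
  have hheq : ∀ t ∈ Icc c d, h t = g (y t) := fun t ht => IccExtend_of_mem _ _ ht
  set G : ℝ → E := fun t => ∫ u in c..t, h u with hG
  have hGd : ∀ t, HasDerivAt G (h t) t := fun t => (hhc.integral_hasStrictDerivAt c t).hasDerivAt
  have hGac : AbsolutelyContinuousOnInterval G c d := by
    have hcd1 : ContDiff ℝ 1 G := contDiff_one_iff_deriv.2
      ⟨fun t => (hGd t).differentiableAt, by
        have : deriv G = h := funext fun t => (hGd t).deriv
        rwa [this]⟩
    exact hcd1.contDiffOn.absolutelyContinuousOnInterval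
  have hyac : AbsolutelyContinuousOnInterval y c d := hac.mono (by
    rw [uIcc_of_le hcd, uIcc_of_le hab]; exact hsub)
  obtain ⟨K, hK⟩ := (hyac.sub hGac).const_of_ae_hasDerivAt_zero (by
    filter_upwards [hd] with t ht htm
    rw [uIcc_of_le hcd] at htm
    have := (ht (hsub htm) (hnz t htm)).sub (hGd t)
    rwa [hheq t htm, sub_self] at this)
  rw [uIcc_of_le hcd] at hK
  have hfin : HasDerivWithinAt y (g (y t₀)) (Icc c d) t₀ := by
    have h1 := ((hGd t₀).const_add K).hasDerivWithinAt (s := Icc c d)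
    rw [hheq t₀ ⟨hct, htd⟩] at h1
    have hyG : ∀ t ∈ Icc c d, y t = K + G t := fun t ht => by
      rw [← hK t ht]; simp
    exact h1.congr hyG (hyG t₀ ⟨hct, htd⟩)
  refine hfin.mono_of_mem_nhdsWithin ?_
  filter_upwards [self_mem_nhdsWithin, mem_nhdsWithin_of_mem_nhds
    (Ioo_mem_nhds (show t₀ - ε / 2 < t₀ by linarith) (show t₀ < t₀ + ε / 2 by linarith))]
    with t ht ht'
  exact ⟨max_le ht.1 ht'.1.le, le_min ht.2 ht'.2.le⟩

namespace HomSystem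

variable {ι : Type*} [Fintype ι] (S : HomSystem ι) {κ : Type*} [Fintype κ]

variable (κ) in
/-- Independent copies of the homogeneous field. -/
def prodField (e : κ → ι → ℝ) : κ → ι → ℝ := fun i => S.field (e i)

/-- Continuity of the field at `e i` confines the `i`-th component to an arbitrarily small closed
ball, which survives the closed convex hull even if other components vanish. -/
lemma eq_of_mem_filippov {e w : κ → ι → ℝ} (hw : w ∈ filippov (S.prodField κ) e) {i : κ}
    (hi : e i ≠ 0) : w i = S.field (e i) := by
  refine eq_of_forall_dist_le fun ε hε => ?_
  obtain ⟨δ, hδ, h⟩ := Metric.continuousAt_iff.1 (S.continuousAt_field hi) ε hε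
  have hw' := mem_iInter₂.1 (mem_iInter₂.1 hw δ hδ) ∅ measure_empty
  have hcl : IsClosed {z : κ → ι → ℝ | z i ∈ Metric.closedBall (S.field (e i)) ε} :=
    Metric.isClosed_closedBall.preimage (continuous_apply i)
  have hcv : Convex ℝ {z : κ → ι → ℝ | z i ∈ Metric.closedBall (S.field (e i)) ε} :=
    (convex_closedBall (S.field (e i)) ε).linear_preimage
      (LinearMap.proj (R := ℝ) (φ := fun _ : κ => ι → ℝ) i)
  have hsub : S.prodField κ '' (Metric.ball e δ \ ∅) ⊆
      {z : κ → ι → ℝ | z i ∈ Metric.closedBall (S.field (e i)) ε} := by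
    rintro _ ⟨z, ⟨hz, -⟩, rfl⟩
    exact (h ((dist_le_pi_dist z e i).trans_lt hz)).le
  exact closure_minimal (convexHull_min hsub hcv) hcl hw'

/-- Reflecting exactly the blocks that vanish at `e` preserves both measure and distance to `e`. By
oddness, averaging the field over this reflection kills the discontinuous blocks, so the average is
continuous at `e` and can be evaluated along points that avoid the null set together with their
reflections. -/
lemma prodField_mem_filippov (e : κ → ι → ℝ) :
    S.prodField κ e ∈ filippov (S.prodField κ) e := by
  classical
  refine mem_iInter₂.2 fun δ hδ => mem_iInter₂.2 fun A hA => ?_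
  set φ : (κ → ι → ℝ) → κ → ι → ℝ := fun z i => if e i = 0 then -z i else z i with hφ
  have hφm : MeasurePreserving φ volume volume := by
    refine volume_preserving_pi (f := fun i (v : ι → ℝ) => if e i = 0 then -v else v) fun i => ?_
    by_cases h : e i = 0
    · simp only [h, if_true]
      exact Measure.measurePreserving_neg volume
    · simp only [h, if_false]
      exact MeasurePreserving.id volume
  have hA' : volume (A ∪ φ ⁻¹' A) = 0 :=
    measure_union_null hA (hφm.quasiMeasurePreserving.preimage_null hA)
  have hdist : ∀ z, dist (φ z) e = dist z e := by
    intro z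
    simp only [dist_pi_def]
    congr 2
    funext i
    by_cases h : e i = 0
    · simp [hφ, h, nndist_eq_nnnorm]
    · simp [hφ, h]
  set mean : (κ → ι → ℝ) → κ → ι → ℝ :=
    fun z => (1 / 2 : ℝ) • S.prodField κ z + (1 / 2 : ℝ) • S.prodField κ (φ z) with hmean
  have hmean_eq : ∀ z i, mean z i = if e i = 0 then 0 else S.field (z i) := by
    intro z i
    by_cases h : e i = 0
    · simp [hmean, prodField, hφ, h, field_neg]
    · simp only [hmean, prodField, hφ, h, if_false, Pi.add_apply, Pi.smul_apply]
      rw [← add_smul]; norm_num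
  have hme : mean e = S.prodField κ e := by
    funext i
    rw [hmean_eq, prodField]
    split_ifs with h
    · rw [h, field_zero]
    · rfl
  have hcont : ContinuousAt mean e := by
    refine continuousAt_pi.2 fun i => ?_
    simp only [hmean_eq]
    by_cases h : e i = 0
    · simpa only [h, if_true] using continuousAt_const
    · simp only [h, if_false]
      exact ContinuousAt.comp (f := fun z : κ → ι → ℝ => z i) (S.continuousAt_field h)
        (continuous_apply i).continuousAt
  have hdense : Dense (A ∪ φ ⁻¹' A)ᶜ := Measure.dense_of_ae (compl_mem_ae_iff.2 hA')
  have hcl : e ∈ closure (Metric.ball e δ ∩ (A ∪ φ ⁻¹' A)ᶜ) := by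
    have := hdense.open_subset_closure_inter (Metric.isOpen_ball (x := e) (ε := δ))
    exact this (Metric.mem_ball_self hδ)
  rw [← hme]
  refine closure_mono ?_ (hcont.continuousWithinAt.mem_closure_image hcl)
  rintro _ ⟨z, ⟨hzb, hzA⟩, rfl⟩
  rw [mem_compl_iff, mem_union, not_or] at hzA
  have hφz : φ z ∈ Metric.ball e δ := by rwa [Metric.mem_ball, hdist]
  exact convex_convexHull ℝ _
    (subset_convexHull ℝ _ (mem_image_of_mem (S.prodField κ) (mem_sdiff_of_mem hzb hzA.1)))
    (subset_convexHull ℝ _ (mem_image_of_mem (S.prodField κ) (mem_sdiff_of_mem hφz hzA.2)))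
    (by norm_num) (by norm_num) (by norm_num)

variable {S}

lemma isWeakSolutionOn_of_isSolutionOn {y : ℝ → κ → ι → ℝ} {J : Set ℝ}
    (hy : IsSolutionOn S.μ (S.prodField κ) y J) {b : ℝ} (hb : 0 ≤ b) (hJ : Icc 0 b ⊆ J) (i : κ) :
    S.IsWeakSolutionOn (fun t => y t i) (Icc 0 b) := by
  by_cases hμ : S.μ = -1
  · obtain ⟨hac, hd⟩ := hy.2 hμ
    have hac' : AbsolutelyContinuousOnInterval (fun t => y t i) 0 b :=
      squeeze_zero (fun _ => Finset.sum_nonneg fun _ _ => dist_nonneg)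
        (fun _ => Finset.sum_le_sum fun _ _ => dist_le_pi_dist _ _ i) (hac 0 b hb hJ)
    refine ⟨by simpa [uIcc_of_le hb] using hac'.continuousOn, fun t ht hne =>
      hasDerivWithinAt_of_absolutelyContinuous (fun x => S.continuousAt_field) hb hac' ?_ ht hne⟩
    filter_upwards [hd] with t ht htm hne
    obtain ⟨w, hw, hyw⟩ := ht (hJ htm)
    rw [← S.eq_of_mem_filippov hw hne]
    exact hasDerivAt_pi.1 hyw i
  · have h := hy.1 hμ
    have h' : ∀ t ∈ Icc 0 b, HasDerivWithinAt (fun t => y t i) (S.field (y t i)) (Icc 0 b) t :=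
      fun t ht => (hasDerivWithinAt_pi.1 (h t (hJ ht)) i).mono hJ
    exact ⟨fun t ht => (h' t ht).continuousWithinAt, fun t ht _ => h' t ht⟩

variable (S)

lemma exists_isSolutionOn (h₁ : S.μ ≠ -1 → ContinuousAt S.field 0)
    (h₂ : S.μ = -1 → ∀ k, 0 ≤ S.μ + S.r k) (y₀ : κ → ι → ℝ) :
    ∃ y : ℝ → κ → ι → ℝ, y 0 = y₀ ∧ IsSolutionOn S.μ (S.prodField κ) y (Ici 0) := by
  choose y Z hy0 hZs hZ0 hyc hyr hyd using fun i => S.exists_solution (y₀ i)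
  have hright : ∀ t, 0 ≤ t → HasDerivWithinAt (fun t i => y i t)
      (S.prodField κ fun i => y i t) (Ici t) t :=
    fun t ht => hasDerivWithinAt_pi.2 fun i => hyr i t ht
  refine ⟨fun t i => y i t, funext hy0, fun hμ => ?_, fun hμ => ⟨fun a b hab hJ => ?_, ?_⟩⟩
  · intro t ht
    have ht : 0 ≤ t := ht
    rcases ht.eq_or_lt with rfl | htpos
    · exact hright 0 le_rfl
    refine hasDerivWithinAt_pi.2 fun i => ?_
    by_cases htZ : t ∈ Z i
    · have hne : ∀ u ∈ Ioo 0 t, HasDerivAt (y i) (S.field (y i u)) u := fun u hu =>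
        hyd i u hu.1.le fun huZ => hu.2.ne (hZs i huZ htZ)
      -- At the arrival time the left derivative is the limit of the derivatives before it, by
      -- continuity of the field at the origin.
      have hlim : Tendsto (fun u => S.field (y i u)) (𝓝[<] t) (𝓝 (S.field (y i t))) := by
        have : ContinuousAt S.field (y i t) := by rw [hZ0 i t htZ]; exact h₁ hμ
        exact (this.comp (hyc i t ht)).mono_left nhdsWithin_le_nhds
      have hleft : HasDerivWithinAt (y i) (S.field (y i t)) (Iic t) t :=
        hasDerivWithinAt_Iic_of_tendsto_deriv
          (fun u hu => (hne u hu).differentiableAt.differentiableWithinAt)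
          (hyc i t ht).continuousWithinAt (Ioo_mem_nhdsLT htpos) (hlim.congr' (by
            filter_upwards [Ioo_mem_nhdsLT htpos] with u hu using (hne u hu).deriv.symm))
      have := hleft.union (hyr i t ht)
      rw [Iic_union_Ici] at this
      exact this.mono (subset_univ _)
    · exact (hyd i t ht htZ).hasDerivWithinAt
  · have hweak : ∀ i t, 0 ≤ t → S.IsWeakSolutionOn (y i) (Icc 0 t) := fun i t ht =>
      ⟨fun u hu => (hyc i u hu.1).continuousWithinAt, fun u hu hne =>
        (hyd i u hu.1 fun huZ => hne (hZ0 i u huZ)).hasDerivWithinAt⟩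
    -- In the critical degree the field is bounded on sublevel sets of `logNorm`, which trajectories
    -- do not leave. The curve is therefore Lipschitz, hence absolutely continuous.
    choose C hC hbound using fun i => S.exists_norm_field_le (h₂ hμ) (S.logNorm (y i 0))
    have hCs : 0 ≤ ∑ i, C i := Finset.sum_nonneg fun i _ => hC i
    have hnorm : ∀ t, 0 ≤ t → ‖S.prodField κ fun i => y i t‖ ≤ ∑ i, C i := fun t ht =>
      (pi_norm_le_iff_of_nonneg hCs).2 fun i => (hbound i (y i t) fun hne =>
        (hweak i t ht).logNorm_le ht hne).trans
          (Finset.single_le_sum (fun j _ => hC j) (Finset.mem_univ i))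
    have hpos : ∀ t ∈ Icc a b, 0 ≤ t := fun t ht => hJ ht
    have hle : ∀ u ∈ Icc a b, ∀ v ∈ Icc a b, u ≤ v →
        dist (fun i => y i u) (fun i => y i v) ≤ (∑ i, C i) * dist u v := by
      intro u hu v hv huv
      have hp : ∀ t ∈ Icc u v, 0 ≤ t := fun t ht => (hpos u hu).trans ht.1
      have := norm_image_sub_le_of_norm_deriv_right_le_segment (f := fun t i => y i t)
        (a := u) (b := v)
        (fun t ht => (continuousAt_pi.2 fun i => hyc i t (hp t ht)).continuousWithinAt)
        (fun t ht => hright t (hp t (Ico_subset_Icc_self ht)))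
        (fun t ht => hnorm t (hp t (Ico_subset_Icc_self ht))) v (right_mem_Icc.2 huv)
      rw [dist_comm, dist_eq_norm, dist_comm, Real.dist_eq, abs_of_nonneg (sub_nonneg.2 huv)]
      exact this
    have hlip : LipschitzOnWith (∑ i, C i).toNNReal (fun t i => y i t) (uIcc a b) := by
      rw [uIcc_of_le hab]
      refine LipschitzOnWith.of_dist_le_mul fun u hu v hv => ?_
      rw [Real.coe_toNNReal _ hCs]
      rcases le_total u v with h | h
      · exact hle u hu v hv h
      · rw [dist_comm, dist_comm u]
        exact hle v hv u hu h
    exact hlip.absolutelyContinuousOnInterval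
  · have hcount : (⋃ i, Z i).Countable := countable_iUnion fun i => (hZs i).finite.countable
    filter_upwards [compl_mem_ae_iff.2 (hcount.measure_zero volume)] with t ht htJ
    refine ⟨_, S.prodField_mem_filippov _, hasDerivAt_pi.2 fun i => ?_⟩
    exact hyd i t htJ fun h => ht (mem_iUnion.2 ⟨i, h⟩)

theorem wellPosed (h₁ : S.μ ≠ -1 → ContinuousAt S.field 0)
    (h₂ : S.μ = -1 → ∀ k, 0 ≤ S.μ + S.r k) : WellPosed S.μ (S.prodField κ) := by
  intro y₀
  obtain ⟨y, hy0, hy⟩ := S.exists_isSolutionOn h₁ h₂ y₀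
  refine ⟨y, hy0, hy, fun T z _ hz0 hz t ht => funext fun i => ?_⟩
  exact IsWeakSolutionOn.eq_of_initial_eq ht.1
    (isWeakSolutionOn_of_isSolutionOn hz ht.1 (fun u hu => ⟨hu.1, hu.2.trans_lt ht.2⟩) i)
    (isWeakSolutionOn_of_isSolutionOn hy ht.1 Icc_subset_Ici_self i) (by rw [hz0, hy0])

theorem globallyFiniteTimeStable (hμ : S.μ < 0) :
    GloballyFiniteTimeStable S.μ (S.prodField κ) := by
  refine ⟨fun ε hε => ?_, ?_⟩
  · obtain ⟨δ, hδ, h⟩ := S.exists_forall_norm_lt_of_initial hε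
    exact ⟨δ, hδ, fun y hy h0 t ht => (pi_norm_lt_iff hε).2 fun i => h (fun t => y t i) t ht
      (isWeakSolutionOn_of_isSolutionOn hy ht Icc_subset_Ici_self i)
      ((norm_le_pi_norm (y 0) i).trans_lt h0)⟩
  · obtain ⟨T, hT, h⟩ := S.exists_settlingTime hμ
    have hsum : ∀ e : κ → ι → ℝ, 0 ≤ ∑ i, T (e i) := fun e =>
      Finset.sum_nonneg fun i _ => (hT _).le
    -- The summand `1` keeps the time positive when there are no followers.
    refine ⟨fun e => 1 + ∑ i, T (e i), fun e => by have := hsum e; positivity,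
      fun y hy t ht => funext fun i => ?_⟩
    have ht0 : 0 ≤ t := by have := hsum (y 0); linarith
    refine h (fun t => y t i) t ht0
      (isWeakSolutionOn_of_isSolutionOn hy ht0 Icc_subset_Ici_self i) ?_
    have := Finset.single_le_sum (f := fun i => T (y 0 i)) (fun j _ => (hT _).le)
      (Finset.mem_univ i)
    linarith

end HomSystem

/-! ### The communication graph and the transmitted vectors -/

section Graph

variable {N : ℕ} {G : Digraph (Fin (N + 1))}

lemma weight_nonneg {V : Type*} (G : Digraph V) (i j : V) : 0 ≤ weight G i j := by
  unfold weight
  split_ifs <;> norm_num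

lemma weight_of_adj {V : Type*} {G : Digraph V} {i j : V} (h : G.Adj i j) : weight G i j = 1 :=
  if_pos h

lemma sum_weight_pos (hroot : IsRoot G 0) (i : Fin N) : 0 < ∑ j, weight G i.succ j := by
  obtain ⟨j, hj⟩ : ∃ j, G.Adj i.succ j := by
    cases hroot.1 i.succ (Fin.succ_ne_zero i) with
    | single h => exact ⟨_, h⟩
    | tail _ h => exact ⟨_, h⟩
  exact Finset.sum_pos' (fun j _ => weight_nonneg G _ j)
    ⟨j, Finset.mem_univ j, by rw [weight_of_adj hj]; exact one_pos⟩

/-- Maximum principle for functions that are harmonic at the followers. -/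
lemma nonpos_of_harmonic (hroot : IsRoot G 0) {d : Fin (N + 1) → ℝ} (h0 : d 0 = 0)
    (h : ∀ i : Fin N, ∑ j, weight G i.succ j * (d i.succ - d j) = 0) (i : Fin (N + 1)) :
    d i ≤ 0 := by
  obtain ⟨i₀, hi₀⟩ := Finite.exists_max d
  suffices d i₀ = 0 from (hi₀ i).trans this.le
  -- At a maximum the harmonic sum has only nonnegative terms, so every sender to a maximal node is
  -- maximal too. Following a path backwards carries the maximum to the leader.
  have step : ∀ a c, G.Adj c a → d c = d i₀ → d a = d i₀ := by
    intro a c hca hc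
    obtain ⟨b, rfl⟩ := Fin.exists_succ_eq.2 (fun e => hroot.2 a (e ▸ hca) : c ≠ 0)
    have hnn : ∀ j ∈ Finset.univ, 0 ≤ weight G b.succ j * (d b.succ - d j) := fun j _ =>
      mul_nonneg (weight_nonneg G _ j) (sub_nonneg.2 (hc ▸ hi₀ j))
    have := (Finset.sum_eq_zero_iff_of_nonneg hnn).1 (h b) a (Finset.mem_univ a)
    rw [weight_of_adj hca, one_mul] at this
    linarith
  have path : ∀ c, Relation.TransGen (fun a b => G.Adj b a) 0 c → d c = d i₀ → d 0 = d i₀ := by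
    intro c hc
    induction hc with
    | single h => exact step _ _ h
    | tail _ h ih => exact fun e => ih (step _ _ h e)
  by_cases hz : i₀ = 0
  · rw [hz, h0]
  · rw [← path i₀ (hroot.1 i₀ hz) rfl, h0]

/-- Each coordinate of `v - e` is harmonic at the followers and vanishes at the leader; the maximum
principle is applied to it and to its negative. -/
lemma transmittedEq_iff (hroot : IsRoot G 0) {n : ℕ} (x v : Fin (N + 1) → Fin n → ℝ) :
    TransmittedEq G x v ↔ ∀ i, v i = x i - x 0 := by
  have hW := sum_weight_pos hroot
  constructor
  · rintro ⟨h0, h⟩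
    have key : ∀ (k : Fin n) (i : Fin N), ∑ j, weight G i.succ j *
        ((v i.succ k - (x i.succ k - x 0 k)) - (v j k - (x j k - x 0 k))) = 0 := by
      intro k i
      have hk := congrFun (h i) k
      simp only [Pi.smul_apply, Finset.sum_apply, smul_eq_mul, Pi.add_apply, Pi.sub_apply] at hk
      rw [one_div, eq_inv_mul_iff_mul_eq₀ (hW i).ne', Finset.sum_mul] at hk
      rw [← sub_eq_zero.2 hk, ← Finset.sum_sub_distrib]
      exact Finset.sum_congr rfl fun j _ => by ring
    intro i
    funext k
    have h0k : v 0 k = 0 := by rw [h0]; rfl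
    have hle := nonpos_of_harmonic hroot (d := fun i => v i k - (x i k - x 0 k)) (by simp [h0k])
      (key k) i
    have hge := nonpos_of_harmonic hroot (d := fun i => -(v i k - (x i k - x 0 k)))
      (by simp [h0k]) (fun i => by
        rw [← neg_eq_zero, ← Finset.sum_neg_distrib, ← key k i]
        exact Finset.sum_congr rfl fun j _ => by ring) i
    rw [Pi.sub_apply]
    linarith
  · intro h
    refine ⟨by rw [h 0, sub_self], fun i => ?_⟩
    have : ∀ j, weight G i.succ j • (x i.succ - x j + v j) = weight G i.succ j • v i.succ := by
      intro j
      rw [h j, h i.succ]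
      congr 1
      abel
    rw [Finset.sum_congr rfl fun j _ => this j, ← Finset.sum_smul, smul_smul, one_div,
      inv_mul_cancel₀ (hW i).ne', one_smul]

lemma existsUnique_input (hroot : IsRoot G 0) {n : ℕ} (μ : ℝ) (K : Matrix (Fin 1) (Fin n) ℝ)
    (P : Matrix (Fin n) (Fin n) ℝ) (x : Fin (N + 1) → Fin n → ℝ) :
    ∃! p : (Fin (N + 1) → Fin n → ℝ) × (Fin (N + 1) → ℝ),
      TransmittedEq G x p.1 ∧ ProtocolEq μ K P p.1 p.2 := by
  refine ⟨(fun i => x i - x 0, Fin.cons 0 fun i : Fin N =>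
    -((hnorm μ P (x i.succ - x 0)) ^ (1 + μ) * Matrix.mulVec
      (K * dil n μ (-Real.log (hnorm μ P (x i.succ - x 0)))) (x i.succ - x 0) 0)),
    ⟨(transmittedEq_iff hroot _ _).2 fun _ => rfl, by simp, fun i => by simp⟩, ?_⟩
  rintro ⟨v, u⟩ ⟨hv, hu0, hu⟩
  obtain rfl : v = fun i => x i - x 0 := funext ((transmittedEq_iff hroot _ _).1 hv)
  refine Prod.ext rfl (funext fun i => ?_)
  cases i using Fin.cases with
  | zero => simpa using hu0
  | succ i => simpa using hu i

end Graph

/-! ### The closed loop as a homogeneous system -/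

section ClosedLoop

variable {n : ℕ} {μ : ℝ}

lemma agentField_sub_eq (K : Matrix (Fin 1) (Fin n) ℝ) (P : Matrix (Fin n) (Fin n) ℝ) {N : ℕ}
    {G : Digraph (Fin (N + 1))} (hroot : IsRoot G 0) {x v : Fin (N + 1) → Fin n → ℝ}
    {u : Fin (N + 1) → ℝ} (hv : TransmittedEq G x v) (hu : ProtocolEq μ K P v u) (i : Fin N) :
    agentField n (x i.succ) (u i.succ) - agentField n (x 0) (u 0) =
      errorField n N μ K P (fun k => x k.succ - x 0) i := by
  have hvi := (transmittedEq_iff hroot x v).1 hv i.succ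
  set h := hnorm μ P (x i.succ - x 0) with hh
  have hui : (fun _ : Fin 1 => u i.succ) =
      -(h ^ (1 + μ) • (K * dil n μ (-Real.log h)) *ᵥ (x i.succ - x 0)) := by
    funext j
    rw [Subsingleton.elim j 0, hu.2 i, hvi]
    rfl
  have hu0 : (fun _ : Fin 1 => u 0) = 0 := by
    funext j
    exact hu.1
  simp only [agentField, errorField, ← hh]
  rw [hui, hu0, sub_mulVec, smul_mulVec, mulVec_neg, mulVec_smul, mulVec_zero, mulVec_mulVec,
    Matrix.mul_assoc, mulVec_sub (matA n)]
  abel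

lemma one_sub_mul_pos (hμ : μ * ((n : ℝ) - 1) < 1) {a : ℝ} (h0 : 0 ≤ a) (ha : a ≤ n - 1) :
    0 < 1 - μ * a := by
  rcases le_total 0 μ with h | h <;> nlinarith

/-- With `z = X⁻¹ x` the expression is `zᵀ T z`, half the quadratic form of `T + Tᵀ`. Both remaining
parts of the LMI have this shape, with `T = G_d X` and `T = -(A X - B Y)`. -/
lemma dotProduct_inv_mulVec_pos {X T : Matrix (Fin n) (Fin n) ℝ} (hX : X.PosDef)
    (hT : (T + T.transpose).PosDef) {x : Fin n → ℝ} (hx : x ≠ 0) :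
    0 < x ⬝ᵥ X⁻¹ *ᵥ ((T * X⁻¹) *ᵥ x) := by
  have hsymm : X⁻¹.transpose = X⁻¹ := by
    have := hX.inv.isHermitian.eq
    rwa [conjTranspose_eq_transpose_of_trivial] at this
  have hdet : IsUnit X.det := (Matrix.isUnit_iff_isUnit_det X).1 hX.isUnit
  have hz : X⁻¹ *ᵥ x ≠ 0 := by
    intro h
    apply hx
    rw [← one_mulVec x, ← mul_nonsing_inv X hdet, ← mulVec_mulVec, h, mulVec_zero]
  have := hT.dotProduct_mulVec_pos hz
  rw [star_trivial, add_mulVec, dotProduct_add] at this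
  have e : ∀ z : Fin n → ℝ, z ⬝ᵥ T.transpose *ᵥ z = z ⬝ᵥ T *ᵥ z := fun z => by
    rw [mulVec_transpose, dotProduct_comm, ← dotProduct_mulVec]
  have e2 : ∀ w, (X⁻¹ *ᵥ x) ⬝ᵥ w = x ⬝ᵥ X⁻¹ *ᵥ w := fun w => by
    rw [dotProduct_mulVec x, ← mulVec_transpose, hsymm]
  rw [e, e2, mulVec_mulVec x T X⁻¹] at this
  linarith

/-- The closed loop of a single agent as a homogeneous system. -/
def closedLoop (hμ : μ * ((n : ℝ) - 1) < 1) {X : Matrix (Fin n) (Fin n) ℝ}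
    {Y : Matrix (Fin 1) (Fin n) ℝ} (hLMI : SolvesLMI n μ X Y) : HomSystem (Fin n) where
  r k := 1 - μ * ((n : ℝ) - ((k : ℕ) + 1 : ℝ))
  P := X⁻¹
  M := matA n - matB n * (Y * X⁻¹)
  μ := μ
  r_pos k := by
    have h : ((k : ℕ) : ℝ) + 1 ≤ n := by exact_mod_cast k.2
    have h' : (0 : ℝ) ≤ (k : ℕ) := Nat.cast_nonneg _
    exact one_sub_mul_pos hμ (by linarith) (by linarith)
  P_symm := by
    have := hLMI.1.inv.isHermitian.eq
    rwa [conjTranspose_eq_transpose_of_trivial] at this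
  P_pos x hx := by simpa using hLMI.1.inv.dotProduct_mulVec_pos hx
  G_pos x hx := by
    have hX : X.transpose = X := by
      have := hLMI.1.isHermitian.eq
      rwa [conjTranspose_eq_transpose_of_trivial] at this
    have hdet : IsUnit X.det := (Matrix.isUnit_iff_isUnit_det X).1 hLMI.1.isUnit
    have := dotProduct_inv_mulVec_pos (T := genG n μ * X) hLMI.1 (by
      rw [transpose_mul, hX, genG, diagonal_transpose]
      exact hLMI.2.1) hx
    rw [Matrix.mul_assoc, mul_nonsing_inv X hdet, Matrix.mul_one] at this
    have e : genG n μ *ᵥ x = (fun k : Fin n => 1 - μ * ((n : ℝ) - ((k : ℕ) + 1 : ℝ))) * x := by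
      funext k
      rw [genG, mulVec_diagonal, Pi.mul_apply]
    rwa [e] at this
  M_neg x hx := by
    have hX : X.transpose = X := by
      have := hLMI.1.isHermitian.eq
      rwa [conjTranspose_eq_transpose_of_trivial] at this
    have hdet : IsUnit X.det := (Matrix.isUnit_iff_isUnit_det X).1 hLMI.1.isUnit
    have := dotProduct_inv_mulVec_pos (T := -(matA n * X - matB n * Y)) hLMI.1 (by
      convert hLMI.2.2 using 1
      rw [transpose_neg, transpose_sub, transpose_mul, transpose_mul, hX]
      abel) hx
    rw [Matrix.neg_mul, Matrix.sub_mul, Matrix.mul_assoc, mul_nonsing_inv X hdet, Matrix.mul_one,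
      Matrix.mul_assoc, neg_mulVec, mulVec_neg, dotProduct_neg] at this
    linarith

variable (hμ : μ * ((n : ℝ) - 1) < 1) {X : Matrix (Fin n) (Fin n) ℝ}
  {Y : Matrix (Fin 1) (Fin n) ℝ} (hLMI : SolvesLMI n μ X Y)

lemma dil_mulVec (s : ℝ) (x : Fin n → ℝ) :
    dil n μ s *ᵥ x = (closedLoop hμ hLMI).scl s x := by
  have : s • genG n μ = diagonal fun k : Fin n => s * (1 - μ * ((n : ℝ) - ((k : ℕ) + 1 : ℝ))) := by
    rw [genG, ← diagonal_smul]
    rfl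
  funext k
  rw [dil, this, exp_diagonal, mulVec_diagonal, Pi.coe_exp, ← Real.exp_eq_exp_ℝ]
  rfl

lemma wnorm_eq_sqrt (x : Fin n → ℝ) : wnorm X⁻¹ x = √((closedLoop hμ hLMI).q x) := rfl

lemma wnorm_dil_eq_one_iff (s : ℝ) (x : Fin n → ℝ) :
    wnorm X⁻¹ (dil n μ s *ᵥ x) = 1 ↔
      (closedLoop hμ hLMI).q ((closedLoop hμ hLMI).scl s x) = 1 := by
  rw [wnorm_eq_sqrt hμ hLMI, dil_mulVec hμ hLMI, Real.sqrt_eq_one]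

lemma hnorm_eq_exp {x : Fin n → ℝ} (hx : x ≠ 0) :
    hnorm μ X⁻¹ x = Real.exp ((closedLoop hμ hLMI).logNorm x) := by
  simp only [hnorm, if_neg hx, wnorm_dil_eq_one_iff hμ hLMI]
  rfl

/-- Consecutive weights differ by `μ`, so the shift is homogeneous of degree `μ`. -/
lemma matA_mulVec_scl (s : ℝ) (x : Fin n → ℝ) :
    matA n *ᵥ (closedLoop hμ hLMI).scl s x =
      Real.exp (μ * s) • (closedLoop hμ hLMI).scl s (matA n *ᵥ x) := by
  funext i
  simp only [mulVec, dotProduct, HomSystem.scl, closedLoop, Pi.smul_apply, smul_eq_mul,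
    Finset.mul_sum, matA, of_apply]
  refine Finset.sum_congr rfl fun j _ => ?_
  split_ifs with h
  · have hj : ((j : ℕ) : ℝ) = (i : ℕ) + 1 := by exact_mod_cast h
    rw [hj, ← mul_assoc, ← mul_assoc, ← Real.exp_add, one_mul, one_mul]
    congr 2
    ring
  · simp

lemma scl_matB_mulVec (s : ℝ) (w : Fin 1 → ℝ) :
    (closedLoop hμ hLMI).scl s (matB n *ᵥ w) = Real.exp s • matB n *ᵥ w := by
  funext i
  simp only [mulVec, dotProduct, HomSystem.scl, closedLoop, Pi.smul_apply, smul_eq_mul,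
    Finset.mul_sum, matB, of_apply]
  refine Finset.sum_congr rfl fun j _ => ?_
  split_ifs with h
  · have hi : ((i : ℕ) : ℝ) + 1 = n := by exact_mod_cast h
    rw [hi, sub_self, mul_zero, sub_zero, mul_one]
  · simp

/-- Pulling `A` and `B` through the dilation gives both terms the common factor `e^{μσ} d(σ)`: the
exponent `1 + μ` of the protocol is `μ` plus the weight `1` of the last coordinate. -/
lemma errorField_eq (N : ℕ) : errorField n N μ (Y * X⁻¹) X⁻¹ =
    (closedLoop hμ hLMI).prodField (Fin N) := by
  funext e i
  set S := closedLoop hμ hLMI with hS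
  rw [errorField, HomSystem.prodField]
  rcases eq_or_ne (e i) 0 with h0 | hne
  · rw [h0, mulVec_zero, S.field_zero]
  rw [hnorm_eq_exp hμ hLMI hne, ← hS, Real.log_exp, ← Real.exp_mul]
  set s := S.logNorm (e i) with hs
  set y := S.scl (-s) (e i) with hy
  have he : e i = S.scl s y := by rw [hy, S.scl_scl, add_neg_cancel, S.scl_zero_left]
  have hM : S.M = matA n - matB n * (Y * X⁻¹) := rfl
  have hSμ : S.μ = μ := rfl
  rw [HomSystem.field, ← hs, ← hy, hM, hSμ, sub_mulVec, smul_mulVec, ← mulVec_mulVec,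
    dil_mulVec hμ hLMI, ← hS, ← hy, sub_mulVec, sub_eq_add_neg (matA n *ᵥ y),
    S.scl_add_right, S.scl_neg_right, ← mulVec_mulVec, hS, scl_matB_mulVec, ← hS, smul_add,
    smul_neg, smul_smul, ← Real.exp_add, he, hS, matA_mulVec_scl, ← sub_eq_add_neg]
  congr 3
  ring

/-- `μ + r k` is the next weight, hence positive, except for the last coordinate, where it is `1 +
μ`. Only there does `μ = -1` cost continuity. -/
lemma deg_add_weight_nonneg (hμ₁ : -1 ≤ μ) (k : Fin n) :
    0 ≤ (closedLoop hμ hLMI).μ + (closedLoop hμ hLMI).r k := by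
  simp only [closedLoop]
  rcases Nat.lt_or_ge (k + 1) n with h | h
  · have h' : ((k : ℕ) : ℝ) + 2 ≤ n := by exact_mod_cast h
    have h0 : (0 : ℝ) ≤ (k : ℕ) := Nat.cast_nonneg _
    have := one_sub_mul_pos hμ (a := (n : ℝ) - (k : ℕ) - 2) (by linarith) (by linarith)
    linarith
  · have hk : ((k : ℕ) : ℝ) + 1 = n := by exact_mod_cast le_antisymm k.2 h
    rw [hk]
    linarith

lemma deg_add_weight_pos (hμ₁ : -1 < μ) (k : Fin n) :
    0 < (closedLoop hμ hLMI).μ + (closedLoop hμ hLMI).r k := by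
  simp only [closedLoop]
  rcases Nat.lt_or_ge (k + 1) n with h | h
  · have h' : ((k : ℕ) : ℝ) + 2 ≤ n := by exact_mod_cast h
    have h0 : (0 : ℝ) ≤ (k : ℕ) := Nat.cast_nonneg _
    have := one_sub_mul_pos hμ (a := (n : ℝ) - (k : ℕ) - 2) (by linarith) (by linarith)
    linarith
  · have hk : ((k : ℕ) : ℝ) + 1 = n := by exact_mod_cast le_antisymm k.2 h
    rw [hk]
    linarith

end ClosedLoop

end LeaderFollowing

end

theorem theorem1 (n N : ℕ) (hn : 1 ≤ n)
    (G : Digraph (Fin (N + 1))) (hloop : ∀ i, ¬ G.Adj i i)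
    (hroot : LeaderFollowing.IsRoot G 0)
    (μ : ℝ) (hμ : -1 ≤ μ) (hμ' : μ * ((n : ℝ) - 1) < 1)
    (X : Matrix (Fin n) (Fin n) ℝ) (Y : Matrix (Fin 1) (Fin n) ℝ)
    (hLMI : LeaderFollowing.SolvesLMI n μ X Y)
    (K : Matrix (Fin 1) (Fin n) ℝ) (hK : K = Y * X⁻¹)
    (P : Matrix (Fin n) (Fin n) ℝ) (hP : P = X⁻¹) :
    -- the canonical homogeneous norm is well defined
    (∀ x : Fin n → ℝ, x ≠ 0 →
      StrictMono (fun s : ℝ =>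
        LeaderFollowing.wnorm P (Matrix.mulVec (LeaderFollowing.dil n μ s) x)) ∧
      ∃! s : ℝ, LeaderFollowing.wnorm P (Matrix.mulVec (LeaderFollowing.dil n μ (-s)) x) = 1) ∧
    -- the averages defining the transmitted vectors are meaningful, and `v = e` is the unique
    -- solution of their equations
    (∀ i : Fin N, 0 < ∑ j, LeaderFollowing.weight G i.succ j) ∧
    (∀ x v : Fin (N + 1) → Fin n → ℝ,
      LeaderFollowing.TransmittedEq G x v ↔ ∀ i, v i = x i - x 0) ∧
    -- the inputs are uniquely determined
    (∀ x : Fin (N + 1) → Fin n → ℝ,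
      ∃! p : (Fin (N + 1) → Fin n → ℝ) × (Fin (N + 1) → ℝ),
        LeaderFollowing.TransmittedEq G x p.1 ∧ LeaderFollowing.ProtocolEq μ K P p.1 p.2) ∧
    -- the closed-loop error `eᵢ = xᵢ - x₀` is governed by the error field
    (∀ (x v : Fin (N + 1) → Fin n → ℝ) (u : Fin (N + 1) → ℝ),
      LeaderFollowing.TransmittedEq G x v → LeaderFollowing.ProtocolEq μ K P v u →
      ∀ i : Fin N,
        LeaderFollowing.agentField n (x i.succ) (u i.succ)
            - LeaderFollowing.agentField n (x 0) (u 0) =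
          LeaderFollowing.errorField n N μ K P (fun k => x k.succ - x 0) i) ∧
    -- the closed-loop error system is well posed
    LeaderFollowing.WellPosed μ (LeaderFollowing.errorField n N μ K P) ∧
    -- and globally finite-time stable for negative degree
    (μ < 0 →
      LeaderFollowing.GloballyFiniteTimeStable μ (LeaderFollowing.errorField n N μ K P)) := by
  subst hK hP
  have hS := LeaderFollowing.errorField_eq hμ' hLMI N
  refine ⟨fun x hx => ⟨?_, ?_⟩, LeaderFollowing.sum_weight_pos hroot,
    LeaderFollowing.transmittedEq_iff hroot,
    LeaderFollowing.existsUnique_input hroot μ _ _,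
    fun x v u hv hu => LeaderFollowing.agentField_sub_eq _ _ hroot hv hu, ?_, fun hneg => ?_⟩
  · intro s t hst
    simp only [LeaderFollowing.wnorm_eq_sqrt hμ' hLMI, LeaderFollowing.dil_mulVec hμ' hLMI]
    exact Real.sqrt_lt_sqrt (LeaderFollowing.HomSystem.q_nonneg _ _)
      ((LeaderFollowing.closedLoop hμ' hLMI).strictMono_q_scl hx hst)
  · simp only [LeaderFollowing.wnorm_dil_eq_one_iff hμ' hLMI]
    exact (LeaderFollowing.closedLoop hμ' hLMI).existsUnique_q_scl hx
  · rw [hS]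
    exact (LeaderFollowing.closedLoop hμ' hLMI).wellPosed
      (fun h => (LeaderFollowing.closedLoop hμ' hLMI).continuousAt_field_zero
        (LeaderFollowing.deg_add_weight_pos hμ' hLMI (lt_of_le_of_ne hμ (Ne.symm h))))
      fun _ => LeaderFollowing.deg_add_weight_nonneg hμ' hLMI hμ
  · rw [hS]
    exact (LeaderFollowing.closedLoop hμ' hLMI).globallyFiniteTimeStable hneg
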